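/- Let $\mathbb P=\mathbb P(1,1,1,2,2)$ be the weighted projective space over $\mathbb C$ with coordinates $[w:x_1:x_2:z_3:z_4]$. For binary quadratic forms $q,q'$, binary quartic forms $Q,Q'$ and constants $c,c'$ (that is, for $b=(c,q,Q,c',q',Q')\in\mathbb A^{18}(\mathbb C)$) put $$F_b=z_3^2+c\,w^4+w^2q(x_1,x_2)+Q(x_1,x_2),\qquad G_b=z_4^2+c'\,w^4+w^2q'(x_1,x_2)+Q'(x_1,x_2),$$ and $V_b=\{F_b=G_b=0\}\subset\mathbb P$. Let $B\subset\mathbb A^{18}$ be the Zariski open subset of those $b$ for which $Q$ and $Q'$ have no common factor, $c$ and $c'$ are not both $0$, and $V_b$ has at most rational double points as singularities. Let $$\mathcal V=\{(b,x)\in B\times\mathbb P\ :\ F_b(x)=G_b(x)=0\}\longrightarrow B$$ be the total space of the family of the surfaces $V_b$, and let $\tau$ be the involution of $\mathcal V$ over $B$ given by $$\tau(b,[w:x_1:x_2:z_3:z_4])=(b,[-w:x_1:x_2:-z_3:-z_4]).$$ Then $\mathcal V$ is a smooth quasi-projective variety over $\mathbb C$; the involution $\tau$ has no fixed points on $\mathcal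 V$; and the quotient $\mathcal S=\mathcal V/\tau\to B$ exists as a scheme over $B$ and is a smooth quasi-projective variety over $\mathbb C$. (A variety is a quasi-projective separated scheme of finite type over $\mathbb C$.) -/

import Mathlib

open CategoryTheory AlgebraicGeometry

noncomputable section

namespace TodorovFamily

section QuotientGrading

variable {R A : Type} [CommRing R] [CommRing A] [Algebra R A]

/-- The grading induced on `A ⧸ I` by a grading `𝒜` of `A`: the degree `n` part is the image of the
degree `n` part of `A`. -/
def quotientGrading (𝒜 : ℕ → Submodule R A) (I : Ideal A) : ℕ → Submodule R (A ⧸ I) :=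
  fun n => (𝒜 n).map (Ideal.Quotient.mkₐ R I).toLinearMap

instance quotientGrading_gradedMonoid (𝒜 : ℕ → Submodule R A) (I : Ideal A)
    [SetLike.GradedMonoid 𝒜] : SetLike.GradedMonoid (quotientGrading 𝒜 I) where
  one_mem := ⟨1, SetLike.GradedOne.one_mem, map_one (Ideal.Quotient.mkₐ R I)⟩
  mul_mem := by
    rintro i j _ _ ⟨a, ha, rfl⟩ ⟨b, hb, rfl⟩
    exact ⟨a * b, SetLike.GradedMul.mul_mem ha hb, map_mul (Ideal.Quotient.mkₐ R I) a b⟩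

variable (𝒜 : ℕ → Submodule R A) [GradedAlgebra 𝒜] (I : Ideal A)

/-- The class of a homogeneous element, as a linear map between graded pieces. -/
def toQuotientPiece (n : ℕ) : 𝒜 n →ₗ[R] quotientGrading 𝒜 I n :=
  ((Ideal.Quotient.mkₐ R I).toLinearMap.restrict fun x hx => ⟨x, hx, rfl⟩)

/-- The homogeneous decomposition of `A`, read modulo `I`. -/
def decomposeModulo : A →ₐ[R] DirectSum ℕ fun n => quotientGrading 𝒜 I n :=
  (DirectSum.toAlgebra R (fun n => 𝒜 n)
      (fun n => DirectSum.lof R ℕ (fun n => quotientGrading 𝒜 I n) n ∘ₗ toQuotientPiece 𝒜 I n)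
      (by rfl)
      (by
        intro i j a b
        simp only [LinearMap.comp_apply, DirectSum.lof_eq_of, DirectSum.of_mul_of]
        rfl)).comp
    (DirectSum.decomposeAlgEquiv 𝒜).toAlgHom

theorem decomposeModulo_of_mem {n : ℕ} (x : 𝒜 n) :
    decomposeModulo 𝒜 I x = DirectSum.of (fun n => quotientGrading 𝒜 I n) n
      (toQuotientPiece 𝒜 I n x) := by
  simp only [decomposeModulo, AlgHom.comp_apply]
  have : (DirectSum.decomposeAlgEquiv 𝒜).toAlgHom (x : A) =
      DirectSum.of (fun n => 𝒜 n) n x := DirectSum.decompose_coe 𝒜 x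
  rw [this]
  exact DirectSum.toAddMonoid_of _ _ _

theorem decomposeModulo_apply (x : A) (n : ℕ) :
    (decomposeModulo 𝒜 I x n : A ⧸ I) = Ideal.Quotient.mk I (DirectSum.decompose 𝒜 x n) := by
  induction x using DirectSum.Decomposition.inductionOn 𝒜 with
  | zero => simp
  | @homogeneous i m =>
    rw [decomposeModulo_of_mem]
    by_cases h : i = n
    · subst h
      simp [DirectSum.decompose_coe]
      rfl
    · rw [DirectSum.of_eq_of_ne _ _ _ (Ne.symm h), DirectSum.decompose_coe,
        DirectSum.of_eq_of_ne _ _ _ (Ne.symm h)]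
      simp
  | add a b ha hb =>
    simp only [map_add, DirectSum.add_apply, Submodule.coe_add, DirectSum.decompose_add, ha, hb]

/-- The quotient of a graded algebra by a homogeneous ideal is graded. -/
@[reducible]
def quotientGradedAlgebra (hI : I.IsHomogeneous 𝒜) : GradedAlgebra (quotientGrading 𝒜 I) :=
  GradedAlgebra.ofAlgHom (quotientGrading 𝒜 I)
    (Ideal.Quotient.liftₐ I (decomposeModulo 𝒜 I) (by
      intro x hx
      ext n
      rw [decomposeModulo_apply, Ideal.Quotient.eq_zero_iff_mem.mpr (hI n hx)]
      rfl))
    (by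
      apply Ideal.Quotient.algHom_ext
      ext x
      induction x using DirectSum.Decomposition.inductionOn 𝒜 with
      | zero => simp
      | @homogeneous i m =>
        change DirectSum.coeAlgHom (quotientGrading 𝒜 I) (decomposeModulo 𝒜 I (m : A)) = _
        rw [decomposeModulo_of_mem, DirectSum.coeAlgHom_of]
        rfl
      | add a b ha hb => simp only [map_add, ha, hb])
    (by
      rintro i ⟨_, x, hx, rfl⟩
      exact decomposeModulo_of_mem 𝒜 I ⟨x, hx⟩)

end QuotientGrading

section ProjStructure

variable {R A : Type} [CommRing R] [CommRing A] [Algebra R A]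

/-- The structure morphism `Proj A ⟶ Spec R` of a graded `R`-algebra `A`. -/
def projToSpec (𝒜 : ℕ → Submodule R A) [GradedAlgebra 𝒜] : Proj 𝒜 ⟶ Spec (.of R) :=
  Proj.toSpecZero 𝒜 ≫ Spec.map (CommRingCat.ofHom (algebraMap R (𝒜 0)))

theorem map_projToSpec (𝒜 : ℕ → Submodule R A) [GradedAlgebra 𝒜] (f : 𝒜 →+*ᵍ 𝒜)
    (hf : HomogeneousIdeal.irrelevant 𝒜 ≤ (HomogeneousIdeal.irrelevant 𝒜).map f)
    (hR : ∀ r : R, f (algebraMap R A r) = algebraMap R A r) :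
    Proj.map f hf ≫ projToSpec 𝒜 = projToSpec 𝒜 := by
  have key : ∀ (i : ℕ) (hi : 0 < i) (x : A) (hx : x ∈ 𝒜 i),
      Proj.awayι 𝒜 (f x) (f.map_mem hx) hi ≫ Proj.map f hf ≫ projToSpec 𝒜 =
        Proj.awayι 𝒜 (f x) (f.map_mem hx) hi ≫ projToSpec 𝒜 := by
    intro i hi x hx
    rw [projToSpec, Proj.awayι_comp_map_assoc f hf hi x hx, Proj.awayι_toSpecZero_assoc,
      Proj.awayι_toSpecZero_assoc, ← Spec.map_comp, ← Spec.map_comp, ← Spec.map_comp]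
    congr 1
    ext r
    have h1 : f ((algebraMap R (𝒜 0) r : 𝒜 0) : A) = ((algebraMap R (𝒜 0) r : 𝒜 0) : A) := hR r
    have h2 : Submonoid.powers x ≤ (Submonoid.powers (f x)).comap f := by
      rintro _ ⟨n, rfl⟩
      exact ⟨n, by simp⟩
    change (HomogeneousLocalization.map f h2 (HomogeneousLocalization.mk _)).val =
      (HomogeneousLocalization.mk _).val
    rw [HomogeneousLocalization.map_mk, HomogeneousLocalization.val_mk,
      HomogeneousLocalization.val_mk]
    exact congrArg₂ Localization.mk h1 (Subtype.ext (map_one f))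
  exact (Proj.mapAffineOpenCover f hf).openCover.hom_ext _ _ fun s =>
    key s.1.1 s.1.2 s.2.1 s.2.2

end ProjStructure

section QuasiProjective

attribute [local instance] MvPolynomial.gradedAlgebra

/-- Projective space `ℙⁿ` over `ℂ`. -/
def projectiveSpace (n : ℕ) : Scheme :=
  Proj (MvPolynomial.homogeneousSubmodule (Fin (n + 1)) ℂ)

/-- The structure morphism of `ℙⁿ` over `ℂ`. -/
def projectiveSpaceToSpec (n : ℕ) : projectiveSpace n ⟶ Spec (.of ℂ) :=
  projToSpec (MvPolynomial.homogeneousSubmodule (Fin (n + 1)) ℂ)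

/-- A `ℂ`-scheme is quasi-projective if it is isomorphic over `ℂ` to a locally closed subscheme
of some projective space. -/
def IsQuasiProjective {X : Scheme} (s : X ⟶ Spec (.of ℂ)) : Prop :=
  ∃ (n : ℕ) (f : X ⟶ projectiveSpace n), IsImmersion f ∧ f ≫ projectiveSpaceToSpec n = s

end QuasiProjective

section RationalDoublePoints

open MvPowerSeries in
/-- The normal forms of the rational double points (Du Val singularities) `A_n` (`n ≥ 1`), `D_n`
(`n ≥ 4`), `E_6`, `E_7`, `E_8` in three variables over `ℂ`. -/
inductive IsDuValEquation : MvPowerSeries (Fin 3) ℂ → Prop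
  | A (n : ℕ) (hn : 1 ≤ n) : IsDuValEquation (X 0 ^ 2 + X 1 ^ 2 + X 2 ^ (n + 1))
  | D (n : ℕ) (hn : 4 ≤ n) : IsDuValEquation (X 0 ^ 2 + X 1 ^ 2 * X 2 + X 2 ^ (n - 1))
  | E6 : IsDuValEquation (X 0 ^ 2 + X 1 ^ 3 + X 2 ^ 4)
  | E7 : IsDuValEquation (X 0 ^ 2 + X 1 ^ 3 + X 1 * X 2 ^ 3)
  | E8 : IsDuValEquation (X 0 ^ 2 + X 1 ^ 3 + X 2 ^ 5)

/-- A local ring is (that of) a rational double point if its completion is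
`ℂ⟦x, y, z⟧ / (f)` for one of the normal forms `f`. -/
def IsRationalDoublePoint (O : Type) [CommRing O] [IsLocalRing O] : Prop :=
  ∃ f : MvPowerSeries (Fin 3) ℂ, IsDuValEquation f ∧
    Nonempty (AdicCompletion (IsLocalRing.maximalIdeal O) O ≃+*
      MvPowerSeries (Fin 3) ℂ ⧸ Ideal.span {f})

/-- Every closed point of `X` is a regular point or a rational double point. -/
def OnlyRationalDoublePoints (X : Scheme.{0}) : Prop :=
  ∀ x : X, IsClosed ({x} : Set X) →
    IsRegularLocalRing (X.presheaf.stalk x) ∨ IsRationalDoublePoint (X.presheaf.stalk x)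

end RationalDoublePoints

section Quotient

/-- `π : X ⟶ Y` is the quotient of the scheme `X` by the involution `τ`: as a topological space `Y`
is the space of orbits of `τ`, and the functions on an open `U ⊆ Y` are the `τ`-invariant functions
on `π⁻¹(U)`. This determines `(Y, π)` up to unique isomorphism. -/
structure IsInvolutionQuotient {X Y : Scheme.{0}} (τ : X ⟶ X) (π : X ⟶ Y) : Prop where
  comp_eq : τ ≫ π = π
  isQuotientMap : Topology.IsQuotientMap π
  fiber : ∀ x y : X, π x = π y ↔ y = x ∨ y = τ x
  functions : ∀ (U : Y.Opens) (s : Γ(X, π ⁻¹ᵁ U)),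
    τ.appLE (π ⁻¹ᵁ U) (π ⁻¹ᵁ U) (by rw [← Scheme.Hom.comp_preimage, comp_eq]) s = s ↔
      ∃! t : Γ(Y, U), π.app U t = s

end Quotient

section Family

open MvPolynomial

/-- The coefficients of a form `c w⁴ + w² q(x₁, x₂) + Q(x₁, x₂)` with `q` a binary quadratic and
`Q` a binary quartic form. -/
inductive Coefficient
  | c
  | q (i : Fin 3)
  | Q (i : Fin 5)

/-- The weights of the coordinates `w, x₁, x₂, z₃, z₄` (in this order). -/
def weight : Fin 5 → ℕ := ![1, 1, 1, 2, 2]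

variable {R : Type} [CommRing R]

/-- The quartic form `Q(x₁, x₂)`. -/
def quarticForm (a : Coefficient → R) : MvPolynomial (Fin 5) R :=
  ∑ i : Fin 5, C (a (.Q i)) * X 1 ^ (4 - (i : ℕ)) * X 2 ^ (i : ℕ)

/-- The quadratic form `q(x₁, x₂)`. -/
def quadraticForm (a : Coefficient → R) : MvPolynomial (Fin 5) R :=
  ∑ i : Fin 3, C (a (.q i)) * X 1 ^ (2 - (i : ℕ)) * X 2 ^ (i : ℕ)

/-- The polynomial `z² + c w⁴ + w² q(x₁, x₂) + Q(x₁, x₂)`, where `z` is the coordinate with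
index `j`. -/
def equation (a : Coefficient → R) (j : Fin 5) : MvPolynomial (Fin 5) R :=
  X j ^ 2 + C (a .c) * X 0 ^ 4 + X 0 ^ 2 * quadraticForm a + quarticForm a

/-- The ideal `(F, G)`, with `F = z₃² + c w⁴ + w² q + Q` and `G = z₄² + c' w⁴ + w² q' + Q'`; the
coefficients of `F` are `b 0` and those of `G` are `b 1`. -/
def idealFG (b : Fin 2 → Coefficient → R) : Ideal (MvPolynomial (Fin 5) R) :=
  Ideal.span {equation (b 0) 3, equation (b 1) 4}

/-- The weighted grading of `R[w, x₁, x₂, z₃, z₄]`. -/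
abbrev polyGrading (R : Type) [CommRing R] : ℕ → Submodule R (MvPolynomial (Fin 5) R) :=
  weightedHomogeneousSubmodule R weight

instance polyGradedAlgebra : GradedAlgebra (polyGrading R) := weightedGradedAlgebra R weight

theorem quadraticForm_homogeneous (a : Coefficient → R) :
    IsWeightedHomogeneous weight (quadraticForm a) 2 := by
  refine IsWeightedHomogeneous.sum _ _ _ fun i _ => ?_
  have h := ((isWeightedHomogeneous_C weight (a (.q i))).mul
    ((isWeightedHomogeneous_X R weight 1).pow (2 - (i : ℕ)))).mul
    ((isWeightedHomogeneous_X R weight 2).pow (i : ℕ))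
  convert h using 1
  fin_cases i <;> simp [weight]

theorem quarticForm_homogeneous (a : Coefficient → R) :
    IsWeightedHomogeneous weight (quarticForm a) 4 := by
  refine IsWeightedHomogeneous.sum _ _ _ fun i _ => ?_
  have h := ((isWeightedHomogeneous_C weight (a (.Q i))).mul
    ((isWeightedHomogeneous_X R weight 1).pow (4 - (i : ℕ)))).mul
    ((isWeightedHomogeneous_X R weight 2).pow (i : ℕ))
  convert h using 1
  fin_cases i <;> simp [weight]

theorem equation_homogeneous (a : Coefficient → R) (j : Fin 5) (hj : weight j = 2) :
    IsWeightedHomogeneous weight (equation a j) 4 := by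
  refine IsWeightedHomogeneous.add (IsWeightedHomogeneous.add (IsWeightedHomogeneous.add ?_ ?_) ?_)
    (quarticForm_homogeneous a)
  · have h := (isWeightedHomogeneous_X R weight j).pow 2
    rwa [hj] at h
  · have h := (isWeightedHomogeneous_C weight (a .c)).mul
      ((isWeightedHomogeneous_X R weight 0).pow 4)
    simpa [weight] using h
  · have h := ((isWeightedHomogeneous_X R weight 0).pow 2).mul (quadraticForm_homogeneous a)
    simpa [weight] using h

theorem idealFG_homogeneous (b : Fin 2 → Coefficient → R) :
    (idealFG b).IsHomogeneous (polyGrading R) := by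
  apply Ideal.homogeneous_span
  rintro x (rfl | rfl)
  · exact ⟨4, equation_homogeneous _ _ rfl⟩
  · exact ⟨4, equation_homogeneous _ _ rfl⟩

/-- The homogeneous coordinate ring `R[w, x₁, x₂, z₃, z₄] / (F, G)`. -/
abbrev CoordRing (b : Fin 2 → Coefficient → R) : Type := MvPolynomial (Fin 5) R ⧸ idealFG b

/-- The weighted grading of the homogeneous coordinate ring. -/
abbrev coordGrading (b : Fin 2 → Coefficient → R) : ℕ → Submodule R (CoordRing b) :=
  quotientGrading (polyGrading R) (idealFG b)

instance coordGradedAlgebra (b : Fin 2 → Coefficient → R) : GradedAlgebra (coordGrading b) :=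
  quotientGradedAlgebra (polyGrading R) (idealFG b) (idealFG_homogeneous b)

/-- The closed subscheme `{F = G = 0}` of the weighted projective space `ℙ(1, 1, 1, 2, 2)` over
`R`. -/
def completeIntersection (b : Fin 2 → Coefficient → R) : Scheme := Proj (coordGrading b)

/-- Its structure morphism to `Spec R`. -/
def completeIntersectionToSpec (b : Fin 2 → Coefficient → R) :
    completeIntersection b ⟶ Spec (.of R) :=
  projToSpec (coordGrading b)

/-- The substitution `w ↦ -w`, `x₁ ↦ x₁`, `x₂ ↦ x₂`, `z₃ ↦ -z₃`, `z₄ ↦ -z₄`. -/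
def signChange : MvPolynomial (Fin 5) R →ₐ[R] MvPolynomial (Fin 5) R :=
  aeval ![-X 0, X 1, X 2, -X 3, -X 4]

theorem signChange_equation (a : Coefficient → R) (j : Fin 5) (hj : j = 3 ∨ j = 4) :
    signChange (equation a j) = equation a j := by
  rcases hj with rfl | rfl <;>
    simp [signChange, equation, quadraticForm, quarticForm, Even.neg_pow (by decide : Even 4)]

theorem idealFG_le_comap (b : Fin 2 → Coefficient → R) :
    idealFG b ≤ (idealFG b).comap (signChange (R := R)) := by
  rw [idealFG, Ideal.span_le]
  rintro x (rfl | rfl)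
  · simpa [signChange_equation] using Ideal.subset_span (by simp)
  · simpa [signChange_equation] using Ideal.subset_span (by simp)

theorem signChange_homogeneous {φ : MvPolynomial (Fin 5) R} {n : ℕ}
    (h : IsWeightedHomogeneous weight φ n) : IsWeightedHomogeneous weight (signChange φ) n := by
  have hX : ∀ i : Fin 5, IsWeightedHomogeneous weight
      ((![-X 0, X 1, X 2, -X 3, -X 4] : Fin 5 → MvPolynomial (Fin 5) R) i) (weight i) := by
    intro i
    have := isWeightedHomogeneous_X R weight i
    fin_cases i
    exacts [this.neg, this, this, this.neg, this.neg]
  rw [signChange, aeval_def, eval₂_eq]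
  refine IsWeightedHomogeneous.sum _ _ _ fun d hd => ?_
  have h' := (isWeightedHomogeneous_C weight (coeff d φ)).mul
    (IsWeightedHomogeneous.prod d.support (fun i => (![-X 0, X 1, X 2, -X 3, -X 4] :
      Fin 5 → MvPolynomial (Fin 5) R) i ^ d i) (fun i => d i • weight i)
      (fun i _ => (hX i).pow (d i)))
  rw [zero_add] at h'
  have hw := h (mem_support_iff.mp hd)
  rw [Finsupp.weight_apply, Finsupp.sum] at hw
  rw [hw] at h'
  exact h'

/-- The involution of the homogeneous coordinate ring given by the sign change. -/
def coordInvolution (b : Fin 2 → Coefficient → R) : coordGrading b →+*ᵍ coordGrading b where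
  toRingHom := Ideal.quotientMap (idealFG b) (signChange (R := R)).toRingHom (idealFG_le_comap b)
  map_mem := by
    rintro i _ ⟨x, hx, rfl⟩
    exact ⟨signChange x, signChange_homogeneous hx, rfl⟩

theorem coordInvolution_involutive (b : Fin 2 → Coefficient → R) (x : CoordRing b) :
    coordInvolution b (coordInvolution b x) = x := by
  obtain ⟨p, rfl⟩ := Ideal.Quotient.mk_surjective x
  have h : (signChange (R := R)).comp signChange = AlgHom.id R _ := by
    ext i : 1
    fin_cases i <;> simp [signChange]
  exact congrArg (Ideal.Quotient.mk (idealFG b)) (AlgHom.congr_fun h p)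

theorem coordInvolution_irrelevant (b : Fin 2 → Coefficient → R) :
    HomogeneousIdeal.irrelevant (coordGrading b) ≤
      (HomogeneousIdeal.irrelevant (coordGrading b)).map (coordInvolution b) := by
  rw [HomogeneousIdeal.irrelevant_le]
  intro i hi x hx
  have := Ideal.mem_map_of_mem (coordInvolution b)
    (HomogeneousIdeal.mem_irrelevant_of_mem (coordGrading b) hi ((coordInvolution b).map_mem hx))
  exact (coordInvolution_involutive b x) ▸ this

/-- The involution `[w : x₁ : x₂ : z₃ : z₄] ↦ [-w : x₁ : x₂ : -z₃ : -z₄]` of the complete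
intersection `{F = G = 0}`. -/
def involution (b : Fin 2 → Coefficient → R) : completeIntersection b ⟶ completeIntersection b :=
  Proj.map (coordInvolution b) (coordInvolution_irrelevant b)

theorem involution_toSpec (b : Fin 2 → Coefficient → R) :
    involution b ≫ completeIntersectionToSpec b = completeIntersectionToSpec b :=
  map_projToSpec _ _ _ fun r =>
    congrArg (Ideal.Quotient.mk (idealFG b)) ((signChange (R := R)).commutes r)

/-- The parameters allowed in the family: `Q, Q'` have no common factor, `c, c'` are not both zero,
and the surface `{F = G = 0}` in `ℙ(1, 1, 1, 2, 2)` has at most rational double points. -/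
structure IsAdmissible (b : Fin 2 → Coefficient → ℂ) : Prop where
  isRelPrime : IsRelPrime (quarticForm (b 0)) (quarticForm (b 1))
  c_ne_zero : b 0 .c ≠ 0 ∨ b 1 .c ≠ 0
  singularities : OnlyRationalDoublePoints (completeIntersection b)

/-- The coordinate ring of the affine space `𝔸¹⁸` of all pairs `(F, G)`. -/
abbrev ParameterRing : Type := MvPolynomial (Fin 2 × Coefficient) ℂ

/-- The affine space `𝔸¹⁸` of all pairs `(F, G)`. Since `z₃²` and `z₄²` have coefficient `1`, distinct
points give pairs `([F], [G])` that are distinct up to scalars: `𝔸¹⁸` is the open subset of `ℙ⁹ × ℙ⁹`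
where the coefficients of `z₃²` and `z₄²` do not vanish. -/
abbrev parameterSpace : Scheme := Spec (.of ParameterRing)

/-- The closed point of `𝔸¹⁸` with coordinates `b`. -/
def parameterPoint (b : Fin 2 → Coefficient → ℂ) : parameterSpace :=
  (⟨RingHom.ker (MvPolynomial.eval fun k : Fin 2 × Coefficient => b k.1 k.2),
    RingHom.ker_isPrime _⟩ : PrimeSpectrum ParameterRing)

/-- The open subscheme `B` of `𝔸¹⁸` that parametrizes the admissible pairs: the largest open
subset all of whose complex points are admissible (admissibility is a Zariski open condition). -/
def base : parameterSpace.Opens :=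
  sSup {U | ∀ b, parameterPoint b ∈ U → IsAdmissible b}

/-- The coefficients of the universal pair `(F, G)`. -/
def universalPair : Fin 2 → Coefficient → ParameterRing := fun k m => X (k, m)

/-- The part of the incidence variety `{(b, x) | F_b(x) = G_b(x) = 0} ⊆ 𝔸¹⁸ × ℙ(1, 1, 1, 2, 2)`
that lies over `B`, as an open subset. -/
def totalOpen : (completeIntersection universalPair).Opens :=
  completeIntersectionToSpec universalPair ⁻¹ᵁ base

/-- The total space `𝒱` of the family of the complete intersections `V_b`, `b ∈ B`. -/
def totalSpace : Scheme := totalOpen.toScheme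

/-- The projection `𝒱 ⟶ B`. -/
def totalSpaceToBase : totalSpace ⟶ base.toScheme :=
  (completeIntersectionToSpec universalPair).resLE base totalOpen le_rfl

/-- The structure morphism `B ⟶ Spec ℂ`. -/
def baseToSpec : base.toScheme ⟶ Spec (.of ℂ) :=
  base.ι ≫ Spec.map (CommRingCat.ofHom (algebraMap ℂ ParameterRing))

/-- The involution `τ` of `𝒱`, which is `(b, x) ↦ (b, τ'(x))`. -/
def totalInvolution : totalSpace ⟶ totalSpace :=
  (involution universalPair).resLE totalOpen totalOpen (by
    rw [totalOpen, ← Scheme.Hom.comp_preimage, involution_toSpec])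

end Family

end TodorovFamily

end

/-! Let `X` be the incidence variety over all of `𝔸¹⁸`. At a point with `w = x₁ = x₂ = 0` the
equations would force `z₃ = z₄ = 0`, so `X` is covered by the three charts in which `w`, `x₁` or
`x₂` equals 1. On such a chart the fourth power of the inverted coordinate is 1, and its
coefficients in `F` and `G` (`c, c'`, or the outer coefficients of `Q, Q'`) can be solved for. Hence
each chart is an affine space, with the other four coordinates and the other sixteen parameters as
free variables (`chartEquiv`), and `X` is smooth over `ℂ`.

On a chart, `τ` changes the signs of some of these variables: of `x₁, x₂, z₃, z₄` where `w = 1`, and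
of `w, z₃, z₄` on the other two. A fixed point is one where all negated variables vanish. In the
first case the equations then read `c = c' = 0`; in the others they read `Q = Q' = 0` at a point of
`ℙ¹`, which gives a common linear factor. Both are excluded over `B` (`not_isAdmissible`). The
Jacobson property extends this from complex points to all points of the charts
(`exists_notMem_of_mem_base`).

Projective embeddings come from sections of degree 4. All products of a parameter or 1 with suitable
quartic monomials generate the rings of the charts (`totalSystem_surjective`), so `X` is locally
closed in a projective space. The `τ`-invariant products generate exactly the rings of invariants
(`mem_range_invariantSystem`). The scheme-theoretic image of `X` under the invariant system is
therefore the quotient `X/τ` (`InvolutionCharts.isInvolutionQuotient`), and it is quasi-projective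
by construction.

The quotient is smooth where some negated variable `X i` is nonzero: after `X i ^ 2` is inverted,
the invariants are a localized polynomial ring in `X i ^ 2`, the products `X i * X j` with the other
negated variables, and the fixed variables (`smooth_of_signChange`). Over `B` this covers every
point, so restriction to the preimage of `B` finishes the proof. -/

noncomputable section

/-! ### Degree-zero localizations under ring maps that multiply degrees -/

namespace HomogeneousLocalization

variable {A B σ τ : Type*} [CommRing A] [SetLike σ A] [AddSubgroupClass σ A]
  [CommRing B] [SetLike τ B] [AddSubgroupClass τ B]
  {𝒜 : ℕ → σ} {ℬ : ℕ → τ} [GradedRing 𝒜] [GradedRing ℬ]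

variable {d : ℕ} (f : B →+* A) (hf : ∀ n, ∀ b ∈ ℬ n, f b ∈ 𝒜 (d * n))

/-- The function underlying `HomogeneousLocalization.mapScale`. -/
def mapScaleFun {P : Submonoid B} {Q : Submonoid A} (comap_le : P ≤ Q.comap f)
    (x : HomogeneousLocalization ℬ P) : HomogeneousLocalization 𝒜 Q :=
  let y := x.mk_surjective.choose
  mk ⟨d * y.deg, ⟨_, hf _ _ y.num.2⟩, ⟨_, hf _ _ y.den.2⟩, comap_le y.den_mem⟩

theorem val_mapScaleFun {P : Submonoid B} {Q : Submonoid A} (comap_le : P ≤ Q.comap f)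
    (x : HomogeneousLocalization ℬ P) :
    (mapScaleFun f hf comap_le x).val = IsLocalization.map (Localization Q) f comap_le x.val := by
  conv_rhs => rw [← x.mk_surjective.choose_spec]
  rw [val_mk, Localization.mk_eq_mk', IsLocalization.map_mk', ← Localization.mk_eq_mk']
  rfl

/-- The map of homogeneous localizations induced by a ring homomorphism that multiplies degrees
by `d`. -/
def mapScale {P : Submonoid B} {Q : Submonoid A} (comap_le : P ≤ Q.comap f) :
    HomogeneousLocalization ℬ P →+* HomogeneousLocalization 𝒜 Q where
  toFun := mapScaleFun f hf comap_le
  map_add' x y := val_injective _ (by simp only [val_mapScaleFun, val_add, map_add])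
  map_mul' x y := val_injective _ (by simp only [val_mapScaleFun, val_mul, map_mul])
  map_zero' := val_injective _ (by simp only [val_mapScaleFun, val_zero, map_zero])
  map_one' := val_injective _ (by simp only [val_mapScaleFun, val_one, map_one])

theorem val_mapScale {P : Submonoid B} {Q : Submonoid A} (comap_le : P ≤ Q.comap f)
    (x : HomogeneousLocalization ℬ P) :
    (mapScale f hf comap_le x).val = IsLocalization.map (Localization Q) f comap_le x.val :=
  val_mapScaleFun f hf comap_le x

theorem powers_le_comap_powers {t : B} {s : A} (h : f t = s) :
    Submonoid.powers t ≤ (Submonoid.powers s).comap f := by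
  rintro _ ⟨n, rfl⟩
  exact ⟨n, by simp [h]⟩

/-- The map `(B_t)₀ → (A_s)₀`, with `s` the image of `t`, induced by a ring homomorphism that
multiplies degrees by `d`. -/
def awayScale {t : B} {s : A} (h : f t = s) : Away ℬ t →+* Away 𝒜 s :=
  mapScale f hf (powers_le_comap_powers f h)

theorem val_awayScale_mk {t : B} {s : A} (h : f t = s) {e : ℕ} (ht : t ∈ ℬ e) (n : ℕ) (b : B)
    (hb : b ∈ ℬ (n • e)) :
    (awayScale f hf h (Away.mk ℬ ht n b hb)).val =
      Localization.mk (f b) (⟨s ^ n, n, rfl⟩ : Submonoid.powers s) := by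
  rw [awayScale, val_mapScale, Away.val_mk, Localization.mk_eq_mk', IsLocalization.map_mk',
    ← Localization.mk_eq_mk']
  congr 1
  exact Subtype.ext (by simp [h])

/-- Compatibility with further localization, which makes the local morphisms agree on overlaps of
basic opens. -/
theorem awayScale_awayMap {t u x : B} {s v y : A} (ht : f t = s) {e : ℕ}
    (hue : u ∈ ℬ e) {m : ℕ} (hvm : v ∈ 𝒜 m) (htu : x = t * u) (hsv : y = s * v) (hx : f x = y) :
    (awayMap 𝒜 hvm hsv).comp (awayScale f hf ht) =
      (awayScale f hf hx).comp (awayMap ℬ hue htu) := by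
  ext z
  simp only [RingHom.comp_apply, awayScale, val_mapScale, val_awayMap, Localization.awayLift]
  rw [← RingHom.comp_apply, ← RingHom.comp_apply]
  congr 1
  refine IsLocalization.ringHom_ext (Submonoid.powers t) ?_
  ext b
  simp [IsLocalization.Away.lift]

/-- The element on the left is the `d`-th power of the image of `u / t`, the one on the right is `v
^ d / s ^ d`. The exponent is harmless, since only the open sets where these functions are
invertible matter. -/
theorem awayScale_isLocalizationElem {t u : B} {s v : A} (ht : f t = s) (hu : f u = v)
    (htd : t ∈ ℬ 1) (hud : u ∈ ℬ 1) (hsd : s ∈ 𝒜 d) (hvd : v ∈ 𝒜 d) :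
    awayScale f hf ht (Away.isLocalizationElem htd hud) ^ d =
      Away.isLocalizationElem hsd hvd := by
  ext
  rw [val_pow, Away.isLocalizationElem, val_awayScale_mk, Away.isLocalizationElem, Away.val_mk,
    Localization.mk_pow]
  congr 1
  · simp [hu]
  · exact Subtype.ext (by simp)

end HomogeneousLocalization

/-! ### Morphisms of Proj induced by ring maps that multiply degrees -/

namespace AlgebraicGeometry.Proj

open HomogeneousLocalization Limits

variable {A B σ τ : Type} [CommRing A] [SetLike σ A] [AddSubgroupClass σ A]
  [CommRing B] [SetLike τ B] [AddSubgroupClass τ B]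
  {𝒜 : ℕ → σ} {ℬ : ℕ → τ} [GradedRing 𝒜] [GradedRing ℬ]

variable {d : ℕ} (hd : 0 < d) (f : B →+* A) (hf : ∀ n, ∀ b ∈ ℬ n, f b ∈ 𝒜 (d * n))

variable {ι : Type} (t : ι → B) (ht : ∀ i, t i ∈ ℬ 1)
  (hcover : ⨆ i, Proj.basicOpen 𝒜 (f (t i)) = ⊤)

theorem map_mem_scale (hf : ∀ n, ∀ b ∈ ℬ n, f b ∈ 𝒜 (d * n)) {b : B} (hb : b ∈ ℬ 1) : f b ∈ 𝒜 d := by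
  simpa using hf 1 b hb

/-- The cover of `Proj A` by the basic opens of the images of the elements `t i`. -/
def scaleCover : (Proj 𝒜).AffineOpenCover where
  I₀ := ι
  X i := .of (Away 𝒜 (f (t i)))
  f i := awayι 𝒜 (f (t i)) (map_mem_scale f hf (ht i)) hd
  idx x := (TopologicalSpace.Opens.mem_iSup.mp (hcover.ge (Set.mem_univ x))).choose
  covers x := by
    change x ∈ (awayι 𝒜 _ _ _).opensRange
    rw [opensRange_awayι]
    exact (TopologicalSpace.Opens.mem_iSup.mp (hcover.ge (Set.mem_univ x))).choose_spec

/-- The gluing condition. The overlap is the spectrum of the localization at the product, where both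
sides become the map induced by `f`. -/
theorem pullback_awayι_scale (i j : ι) :
    pullback.fst (awayι 𝒜 (f (t i)) (map_mem_scale f hf (ht i)) hd)
        (awayι 𝒜 (f (t j)) (map_mem_scale f hf (ht j)) hd) ≫
        Spec.map (CommRingCat.ofHom (awayScale f hf rfl)) ≫ awayι ℬ (t i) (ht i) one_pos =
      pullback.snd (awayι 𝒜 (f (t i)) (map_mem_scale f hf (ht i)) hd)
        (awayι 𝒜 (f (t j)) (map_mem_scale f hf (ht j)) hd) ≫
        Spec.map (CommRingCat.ofHom (awayScale f hf rfl)) ≫ awayι ℬ (t j) (ht j) one_pos := by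
  have hi := map_mem_scale (𝒜 := 𝒜) f hf (ht i)
  have hj := map_mem_scale (𝒜 := 𝒜) f hf (ht j)
  rw [← cancel_epi (pullbackAwayιIso 𝒜 hi hd hj hd rfl).inv, pullbackAwayιIso_inv_fst_assoc,
    pullbackAwayιIso_inv_snd_assoc, ← Spec.map_comp_assoc, ← Spec.map_comp_assoc,
    ← CommRingCat.ofHom_comp, ← CommRingCat.ofHom_comp,
    awayScale_awayMap f hf rfl (ht j) hj rfl rfl (map_mul f _ _),
    awayScale_awayMap f hf rfl (ht i) hi (mul_comm (t i) (t j)) _ (map_mul f _ _),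
    CommRingCat.ofHom_comp, CommRingCat.ofHom_comp, Spec.map_comp_assoc, Spec.map_comp_assoc,
    SpecMap_awayMap_awayι, SpecMap_awayMap_awayι]

/-- The morphism `Proj A ⟶ Proj B` induced by a ring homomorphism `f : B → A` that multiplies
degrees by `d > 0`, if `Proj A` is covered by the basic opens of images of elements of degree 1. -/
def mapScale : Proj 𝒜 ⟶ Proj ℬ :=
  (scaleCover hd f hf t ht hcover).openCover.glueMorphisms
    (fun i ↦ Spec.map (CommRingCat.ofHom (awayScale f hf rfl)) ≫ awayι ℬ (t i) (ht i) one_pos)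
    (pullback_awayι_scale hd f hf t ht)

theorem awayι_mapScale (i : ι) :
    awayι 𝒜 (f (t i)) (map_mem_scale f hf (ht i)) hd ≫ mapScale hd f hf t ht hcover =
      Spec.map (CommRingCat.ofHom (awayScale f hf rfl)) ≫ awayι ℬ (t i) (ht i) one_pos :=
  (scaleCover hd f hf t ht hcover).openCover.ι_glueMorphisms _ _ i

/-- This makes the squares formed by the charts cartesian, so that properties of the morphism can be
tested on rings. -/
theorem mapScale_preimage_basicOpen (i : ι) :
    mapScale hd f hf t ht hcover ⁻¹ᵁ basicOpen ℬ (t i) = basicOpen 𝒜 (f (t i)) := by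
  ext x
  obtain ⟨j, hj⟩ := TopologicalSpace.Opens.mem_iSup.mp (hcover.ge (Set.mem_univ x))
  have hj' := map_mem_scale (𝒜 := 𝒜) f hf (ht j)
  rw [← opensRange_awayι 𝒜 _ hj' hd] at hj
  obtain ⟨y, rfl⟩ := hj
  have h1 : awayι 𝒜 (f (t j)) hj' hd ⁻¹ᵁ mapScale hd f hf t ht hcover ⁻¹ᵁ basicOpen ℬ (t i) =
      awayι 𝒜 (f (t j)) hj' hd ⁻¹ᵁ basicOpen 𝒜 (f (t i)) := by
    rw [← Scheme.Hom.comp_preimage, awayι_mapScale, Scheme.Hom.comp_preimage,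
      awayι_preimage_basicOpen _ _ _ (ht i) one_pos,
      awayι_preimage_basicOpen _ _ _ (map_mem_scale f hf (ht i)) hd,
      ← awayScale_isLocalizationElem f hf rfl rfl (ht j) (ht i), PrimeSpectrum.basicOpen_pow _ _ hd]
    rfl
  exact SetLike.ext_iff.mp h1 y

end AlgebraicGeometry.Proj

/-! ### Rings with an involution and their invariants -/

/-- A ring whose involution `σ` has the image of `ψ` as invariants: points with the same image
are conjugate. -/
theorem PrimeSpectrum.eq_or_eq_comap_of_comap_eq {C P : Type*} [CommRing C] [CommRing P]
    (ψ : C →+* P) (σ : P →+* P) (hσ : ∀ a, σ (σ a) = a) (hinv : ∀ a, σ a = a → a ∈ ψ.range)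
    {p q : PrimeSpectrum P} (h : p.comap ψ = q.comap ψ) : q = p ∨ q = p.comap σ := by
  have key : ∀ p q : PrimeSpectrum P, p.comap ψ = q.comap ψ →
      p.asIdeal ≤ q.asIdeal ∨ p.asIdeal ≤ q.asIdeal.comap σ := by
    intro p q h
    -- The norm `b * σ b` is invariant, so it comes from `C` and lies in `q` as soon as `b` lies in
    -- `p`. An ideal contained in a union of two ideals is contained in one of them.
    have h1 : (p.asIdeal : Set P) ⊆ q.asIdeal ∪ q.asIdeal.comap σ := by
      intro b hb
      obtain ⟨c, hc⟩ := hinv (b * σ b) (by rw [map_mul, hσ, mul_comm])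
      have h2 : c ∈ (p.comap ψ).asIdeal := by
        change ψ c ∈ p.asIdeal
        rw [hc]
        exact Ideal.mul_mem_right _ _ hb
      rw [h] at h2
      replace h2 : ψ c ∈ q.asIdeal := h2
      rw [hc] at h2
      exact q.2.mem_or_mem h2
    exact Ideal.subset_union.mp h1
  have hc : ∀ {I J : Ideal P}, I ≤ J.comap σ → I.comap σ ≤ J := by
    intro I J h a ha
    simpa [hσ] using h (show σ a ∈ I from ha)
  -- In the mixed cases one prime is squeezed between the other and its conjugate. As `σ` is an
  -- involution, an inclusion of an ideal in its conjugate is an equality, so everything collapses.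
  rcases key p q h with h1 | h1 <;> rcases key q p h.symm with h2 | h2
  · exact Or.inl (PrimeSpectrum.ext (le_antisymm h2 h1))
  · refine Or.inr (PrimeSpectrum.ext (le_antisymm h2 ?_))
    exact (hc (h1.trans h2)).trans h1
  · exact Or.inl (PrimeSpectrum.ext (le_antisymm h2 (h1.trans (hc (h2.trans h1)))))
  · refine Or.inr (PrimeSpectrum.ext (le_antisymm h2 (hc h1)))

/-- Every `a` is a root of `T² - (a + σ a) T + a σ a`, whose coefficients are invariant. -/
theorem RingHom.isIntegral_of_involution {C P : Type*} [CommRing C] [CommRing P]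
    (ψ : C →+* P) (σ : P →+* P) (hσ : ∀ a, σ (σ a) = a) (hinv : ∀ a, σ a = a → a ∈ ψ.range) :
    ψ.IsIntegral := by
  intro a
  obtain ⟨s, hs⟩ := hinv (a + σ a) (by rw [map_add, hσ, add_comm])
  obtain ⟨m, hm⟩ := hinv (a * σ a) (by rw [map_mul, hσ, mul_comm])
  refine ⟨Polynomial.X ^ 2 - (Polynomial.C s * Polynomial.X - Polynomial.C m), ?_, ?_⟩
  · apply Polynomial.monic_X_pow_sub
    compute_degree!
  · simp [hs, hm]
    ring

/-! ### Invariant sections on charts, and their descent -/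

namespace AlgebraicGeometry

theorem isIso_appLE_top {X Y : Scheme.{0}} (f : X ⟶ Y) [IsOpenImmersion f] {U : Y.Opens}
    (hU : U = f.opensRange) (h : ⊤ ≤ f ⁻¹ᵁ U) : IsIso (f.appLE U ⊤ h) := by
  rw [← Scheme.Hom.image_top_eq_opensRange] at hU
  subst hU
  rw [← Scheme.Hom.appIso_hom']
  infer_instance

/-- The image of a section in the sections over a chart. -/
theorem exists_appLE_eq_of_chart {X W : Scheme.{0}} (g : X ⟶ W) (τ : X ⟶ X) {C P : CommRingCat.{0}}
    (c : Spec C ⟶ W) (j : Spec P ⟶ X) [IsOpenImmersion c] [IsOpenImmersion j] (ψ : C ⟶ P)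
    (σ : P ⟶ P) (hg : j ≫ g = Spec.map ψ ≫ c) (hτ : j ≫ τ = Spec.map σ ≫ j)
    (hinv : ∀ a, σ a = a → a ∈ ψ.hom.range) {U : W.Opens} {V : X.Opens} (hU : U = c.opensRange)
    (hV : V = j.opensRange) (e : V ≤ g ⁻¹ᵁ U) (e' : V ≤ τ ⁻¹ᵁ V) (s : Γ(X, V))
    (hs : τ.appLE V V e' s = s) : ∃ t : Γ(W, U), g.appLE U V e t = s := by
  have hjV : ⊤ ≤ j ⁻¹ᵁ V := by rw [hV, Scheme.Hom.preimage_opensRange]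
  have hcU : ⊤ ≤ c ⁻¹ᵁ U := by rw [hU, Scheme.Hom.preimage_opensRange]
  have hiso1 := isIso_appLE_top j hV hjV
  have hiso2 := isIso_appLE_top c hU hcU
  have hinj : Function.Injective (j.appLE V ⊤ hjV) :=
    ((ConcreteCategory.isIso_iff_bijective _).mp hiso1).1
  set b := j.appLE V ⊤ hjV s with hb
  have hσb : (Spec.map σ).appTop b = b := by
    have h1 : (j ≫ τ).appLE V ⊤ (hjV.trans (fun x hx => e' hx)) =
      (Spec.map σ ≫ j).appLE V ⊤ (by rw [← hτ]; exact (hjV.trans (fun x hx => e' hx))) := by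
      congr 1
    rw [← Scheme.Hom.appLE_comp_appLE j τ V V ⊤ e' hjV,
      ← Scheme.Hom.appLE_comp_appLE (Spec.map σ) j V ⊤ ⊤ hjV le_rfl] at h1
    have h2 := congr($h1 s)
    simp only [CommRingCat.comp_apply, hs] at h2
    rw [Scheme.Hom.appTop, ← Scheme.Hom.appLE_eq_app]
    exact h2.symm
  obtain ⟨a, ha⟩ : ∃ a : P, (Scheme.ΓSpecIso P).inv a = b :=
    ((ConcreteCategory.isIso_iff_bijective _).mp inferInstance).2 b
  obtain ⟨r, hr⟩ : a ∈ ψ.hom.range := by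
    refine hinv a ?_
    apply ((ConcreteCategory.isIso_iff_bijective (Scheme.ΓSpecIso P).inv).mp inferInstance).1
    rw [ha, ← hσb, ← ha, ← CommRingCat.comp_apply, ← CommRingCat.comp_apply, Scheme.ΓSpecIso_inv_naturality]
  obtain ⟨t, ht⟩ := ((ConcreteCategory.isIso_iff_bijective _).mp hiso2).2
    ((Scheme.ΓSpecIso C).inv r)
  refine ⟨t, hinj ?_⟩
  rw [← hb, ← ha, ← hr]
  change _ = (ψ ≫ (Scheme.ΓSpecIso P).inv) r
  rw [Scheme.ΓSpecIso_inv_naturality, CommRingCat.comp_apply, ← ht]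
  have h1 : (j ≫ g).appLE U ⊤ (hjV.trans (fun x hx => e hx)) =
      (Spec.map ψ ≫ c).appLE U ⊤ (by rw [← hg]; exact (hjV.trans (fun x hx => e hx))) := by
    congr 1
  rw [← Scheme.Hom.appLE_comp_appLE j g U V ⊤ e hjV,
    ← Scheme.Hom.appLE_comp_appLE (Spec.map ψ) c U ⊤ ⊤ hcU le_rfl] at h1
  rw [Scheme.Hom.appTop, ← Scheme.Hom.appLE_eq_app]
  exact congr($h1 t)

end AlgebraicGeometry

namespace AlgebraicGeometry

open Opposite TopologicalSpace in
/-- A section of `π_* 𝒪_X` that is locally in the image of `𝒪_S` is in the image of `𝒪_S` if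
`𝒪_S ⟶ π_* 𝒪_X` is injective. -/
theorem exists_app_eq_of_locally {X S : Scheme.{0}} (π : X ⟶ S)
    (hinj : ∀ U, Function.Injective (π.app U)) (U : S.Opens) (s : Γ(X, π ⁻¹ᵁ U))
    (h : ∀ y ∈ U, ∃ (V : S.Opens) (hV : V ≤ U) (_ : y ∈ V) (t : Γ(S, V)),
      π.app V t = X.presheaf.map (homOfLE (π.preimage_mono hV)).op s) :
    ∃ t, π.app U t = s := by
  have h' : ∀ y : U, ∃ (V : S.Opens) (hV : V ≤ U) (_ : y.1 ∈ V) (t : Γ(S, V)),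
      π.app V t = X.presheaf.map (homOfLE (π.preimage_mono hV)).op s := fun y => h y.1 y.2
  choose V hV hy t ht using h'
  have hcov : U ≤ iSup V := fun y hy' => Opens.mem_iSup.mpr ⟨⟨y, hy'⟩, hy _⟩
  -- Injectivity of `π.app` turns local preimages of one section into a compatible family.
  have hcomp : TopCat.Presheaf.IsCompatible S.presheaf V t := by
    intro x y
    apply hinj
    have h1 : ∀ (W : S.Opens) (x : U) (hW : W ≤ V x), π.app W (S.presheaf.map (homOfLE hW).op (t x)) =
        X.presheaf.map (homOfLE (π.preimage_mono (hW.trans (hV x)))).op s := by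
      intro W x hW
      rw [← CommRingCat.comp_apply, Scheme.Hom.naturality, CommRingCat.comp_apply, ht,
        ← CommRingCat.comp_apply, ← Functor.map_comp]
      rfl
    exact (h1 _ x inf_le_left).trans (h1 _ y inf_le_right).symm
  obtain ⟨r, hr, -⟩ := S.sheaf.existsUnique_gluing' V U (fun i => homOfLE (hV i)) hcov t hcomp
  refine ⟨r, ?_⟩
  have hcov' : π ⁻¹ᵁ U ≤ ⨆ i, π ⁻¹ᵁ V i := by
    intro x hx
    obtain ⟨i, hi⟩ := Opens.mem_iSup.mp (hcov hx)
    exact Opens.mem_iSup.mpr ⟨i, hi⟩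
  apply X.sheaf.eq_of_locally_eq' (fun i => π ⁻¹ᵁ V i) (π ⁻¹ᵁ U)
    (fun i => homOfLE (π.preimage_mono (hV i))) hcov'
  intro i
  refine Eq.trans ?_ (ht i)
  have h2 := hr i
  change S.presheaf.map _ r = _ at h2
  rw [← h2]
  change (π.app U ≫ X.presheaf.map _) r = (S.presheaf.map _ ≫ π.app _) r
  rw [Scheme.Hom.naturality]
  rfl

/-- Taking invariants commutes with localization at a function pulled back from the quotient: the
denominator is itself invariant, so an invariant fraction can be given an invariant numerator. -/
theorem exists_app_basicOpen_eq {X S : Scheme.{0}} (π : X ⟶ S) (τ : X ⟶ X) (hπ : τ ≫ π = π)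
    (e : ∀ U, π ⁻¹ᵁ U ≤ τ ⁻¹ᵁ (π ⁻¹ᵁ U)) {U : S.Opens} (hV : IsAffineOpen (π ⁻¹ᵁ U))
    (hsurj : ∀ s, τ.appLE (π ⁻¹ᵁ U) (π ⁻¹ᵁ U) (e U) s = s → ∃ t, π.app U t = s) (r : Γ(S, U))
    (s : Γ(X, π ⁻¹ᵁ S.basicOpen r)) (hs : τ.appLE _ _ (e _) s = s) :
    ∃ t, π.app (S.basicOpen r) t = s := by
  have hi : π ⁻¹ᵁ S.basicOpen r ≤ π ⁻¹ᵁ U := π.preimage_mono (S.basicOpen_le r)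
  let f := π.app U r
  have hloc := hV.isLocalization_of_eq_basicOpen f (homOfLE hi) (Scheme.preimage_basicOpen π r)
  let ρ := X.presheaf.map (homOfLE hi).op
  let := ρ.hom.toAlgebra
  have hτπ : ∀ (W : S.Opens) (t : Γ(S, W)), τ.appLE _ _ (e W) (π.app W t) = π.app W t := by
    intro W t
    rw [Scheme.Hom.app_eq_appLE, ← CommRingCat.comp_apply, Scheme.Hom.appLE_comp_appLE]
    simp only [hπ]
  have hτρ : ∀ a, τ.appLE _ _ (e _) (ρ a) = ρ (τ.appLE _ _ (e U) a) := by
    intro a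
    rw [← CommRingCat.comp_apply, ← CommRingCat.comp_apply, Scheme.Hom.map_appLE,
      Scheme.Hom.appLE_map]
  obtain ⟨⟨a, ⟨_, n, rfl⟩⟩, ha⟩ := IsLocalization.surj (Submonoid.powers f) s
  replace ha : s * ρ (f ^ n) = ρ a := ha
  have hρτ : ρ (τ.appLE _ _ (e U) a) = ρ a := by
    rw [← hτρ, ← ha, map_mul, hs, hτρ, map_pow, hτπ]
  -- The numerator `a` is invariant only after restriction. Another power of `f` makes it invariant
  -- on the whole preimage of `U`.
  obtain ⟨⟨_, m, rfl⟩, hm⟩ := IsLocalization.exists_of_eq (M := Submonoid.powers f) hρτ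
  replace hm : f ^ m * (τ.appLE _ _ (e U) a) = f ^ m * a := hm
  obtain ⟨b, hb⟩ := hsurj (f ^ m * a) (by rw [map_mul, map_pow, hτπ, hm])
  let ρ' := S.presheaf.map (homOfLE (S.basicOpen_le r)).op
  have hnat : ∀ b, π.app _ (ρ' b) = ρ (π.app U b) := by
    intro b
    rw [← CommRingCat.comp_apply, ← CommRingCat.comp_apply, Scheme.Hom.naturality]
    rfl
  have hu : IsUnit (ρ' r) := RingedSpace.isUnit_res_basicOpen S.toRingedSpace r
  obtain ⟨v, hv⟩ := hu.exists_right_inv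
  have hw : ρ f * π.app _ v = 1 := by rw [← hnat, ← map_mul, hv, map_one]
  refine ⟨ρ' b * v ^ (n + m), ?_⟩
  rw [map_mul, hnat, hb, map_mul, ← ha, map_pow, map_pow, map_pow, pow_add]
  generalize π.app _ v = w at hw
  calc ρ f ^ m * (s * ρ f ^ n) * (w ^ n * w ^ m) = s * (ρ f * w) ^ (n + m) := by ring
    _ = s := by rw [hw, one_pow, mul_one]

end AlgebraicGeometry

/-! ### The scheme-theoretic image as a quotient by an involution -/

namespace AlgebraicGeometry

theorem of_isPullback_charts {Q : MorphismProperty Scheme.{0}} [IsZariskiLocalAtTarget Q]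
    {X W : Scheme.{0}} {g : X ⟶ W} {K : Type} {U V : K → Scheme.{0}} (c : ∀ k, V k ⟶ W)
    [∀ k, IsOpenImmersion (c k)] (hc : ⨆ k, (c k).opensRange = ⊤) {j : ∀ k, U k ⟶ X}
    {f : ∀ k, U k ⟶ V k} (h : ∀ k, IsPullback (f k) (j k) (c k) g) (H : ∀ k, Q (f k)) : Q g := by
  refine IsZariskiLocalAtTarget.of_iSup_eq_top _ hc fun k => ?_
  rw [Q.arrow_mk_iso_iff (morphismRestrictOpensRange g (c k)), ← (h k).flip.isoPullback_inv_snd,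
    Q.cancel_left_of_respectsIso]
  exact H k

/-- Charts for a morphism `g : X ⟶ W` that is invariant under an involution `τ` of `X`, in which the
image of functions on `W` is the ring of invariants. -/
structure InvolutionCharts {X W : Scheme.{0}} (g : X ⟶ W) (τ : X ⟶ X) where
  /-- The index set. -/
  K : Type
  /-- The rings of the charts of `W`. -/
  C : K → CommRingCat.{0}
  /-- The rings of the charts of `X`. -/
  P : K → CommRingCat.{0}
  /-- The charts of `W`. -/
  c : ∀ k, Spec (C k) ⟶ W
  /-- The charts of `X`. -/
  j : ∀ k, Spec (P k) ⟶ X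
  /-- The morphism `g` in the charts. -/
  ψ : ∀ k, C k ⟶ P k
  /-- The involution `τ` in the charts. -/
  σ : ∀ k, P k ⟶ P k
  isOpenImmersion_c : ∀ k, IsOpenImmersion (c k)
  isOpenImmersion_j : ∀ k, IsOpenImmersion (j k)
  iSup_c : ⨆ k, (c k).opensRange = ⊤
  j_g : ∀ k, j k ≫ g = Spec.map (ψ k) ≫ c k
  preimage_c : ∀ k, g ⁻¹ᵁ (c k).opensRange = (j k).opensRange
  j_τ : ∀ k, j k ≫ τ = Spec.map (σ k) ≫ j k
  σ_σ : ∀ k a, σ k (σ k a) = a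
  invariants : ∀ k a, σ k a = a → a ∈ (ψ k).hom.range

namespace InvolutionCharts

attribute [instance] isOpenImmersion_c isOpenImmersion_j

variable {X W : Scheme.{0}} {g : X ⟶ W} {τ : X ⟶ X}

theorem isIntegralHom (D : InvolutionCharts g τ) : IsIntegralHom g :=
  have : IsZariskiLocalAtTarget @IsIntegralHom := (HasAffineProperty.iff.mp IsIntegralHom.hasAffineProperty).1
  of_isPullback_charts D.c D.iSup_c
    (fun k => IsOpenImmersion.isPullback (Spec.map (D.ψ k)) (D.j k) (D.c k) g (D.j_g k)
      (D.preimage_c k))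
    (fun k => IsIntegralHom.SpecMap_iff.mpr
      (RingHom.isIntegral_of_involution (D.ψ k).hom (D.σ k).hom (D.σ_σ k) (D.invariants k)))

theorem exists_mem_opensRange (D : InvolutionCharts g τ) (y : W) : ∃ k, y ∈ (D.c k).opensRange :=
  TopologicalSpace.Opens.mem_iSup.mp (D.iSup_c.ge (Set.mem_univ y))

theorem eq_or_eq_of_apply_eq (D : InvolutionCharts g τ) {x y : X}
    (h : g x = g y) : y = x ∨ y = τ x := by
  obtain ⟨k, hk⟩ := D.exists_mem_opensRange (g x)
  have hk' : g y ∈ (D.c k).opensRange := by rwa [← h]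
  obtain ⟨x, rfl⟩ : x ∈ (D.j k).opensRange := by rw [← D.preimage_c]; exact hk
  obtain ⟨y, rfl⟩ : y ∈ (D.j k).opensRange := by rw [← D.preimage_c]; exact hk'
  rw [← Scheme.Hom.comp_apply, ← Scheme.Hom.comp_apply, D.j_g, Scheme.Hom.comp_apply,
    Scheme.Hom.comp_apply] at h
  rw [← Scheme.Hom.comp_apply, D.j_τ, Scheme.Hom.comp_apply]
  rcases PrimeSpectrum.eq_or_eq_comap_of_comap_eq (D.ψ k).hom (D.σ k).hom (D.σ_σ k)
    (D.invariants k) ((D.c k).isOpenEmbedding.injective h) with h1 | h1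
  · exact Or.inl (congrArg _ h1)
  · exact Or.inr (congrArg _ h1)

/-- Topologically, `X` maps onto the image by a closed map, as `g` is integral. For functions,
passing to the image makes the structure sheaf embed in that of `X`, while sections over the charts
of `W` already hit all invariants. -/
theorem isInvolutionQuotient (D : InvolutionCharts g τ) (hτ : τ ≫ g = g) :
    TodorovFamily.IsInvolutionQuotient τ g.toImage := by
  have := D.isIntegralHom
  have hint : IsIntegralHom (g.toImage ≫ g.imageι) := by rwa [Scheme.Hom.toImage_imageι]
  have hint' : IsIntegralHom g.toImage := .of_comp _ g.imageι
  have hcomp : τ ≫ g.toImage = g.toImage := by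
    rw [← cancel_mono g.imageι, Category.assoc, Scheme.Hom.toImage_imageι, hτ]
  have hinj : ∀ U, Function.Injective (g.toImage.app U) := fun U =>
    TopCat.Presheaf.app_injective_of_stalkFunctor_map_injective (F := g.image.sheaf) g.toImage.c U
      fun x _ => g.stalkFunctor_toImage_injective x
  -- Integral morphisms are closed. The range of `g.toImage` is dense as well, so it is everything.
  have hcl : IsClosedMap g.toImage := g.toImage.isClosedMap
  have hsurj : Function.Surjective g.toImage := by
    rw [← Set.range_eq_univ, ← hcl.isClosed_range.closure_eq]
    exact g.toImage.denseRange.closure_range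
  have e : ∀ U, g.toImage ⁻¹ᵁ U ≤ τ ⁻¹ᵁ (g.toImage ⁻¹ᵁ U) := fun U => by
    rw [← Scheme.Hom.comp_preimage, hcomp]
  refine ⟨hcomp, hcl.isQuotientMap g.toImage.continuous hsurj, fun x y => ⟨fun h => ?_, ?_⟩,
    fun U s => ⟨fun hs => ?_, ?_⟩⟩
  · apply D.eq_or_eq_of_apply_eq
    rw [← Scheme.Hom.toImage_imageι g, Scheme.Hom.comp_apply, h, Scheme.Hom.comp_apply]
  · rintro (rfl | rfl)
    · rfl
    · rw [← Scheme.Hom.comp_apply, hcomp]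
  · refine existsUnique_of_exists_of_unique ?_ fun t t' ht ht' => hinj U (ht.trans ht'.symm)
    refine exists_app_eq_of_locally g.toImage hinj U s fun y hy => ?_
    obtain ⟨k, hk⟩ := D.exists_mem_opensRange (g.imageι y)
    have hU0 : IsAffineOpen (g.imageι ⁻¹ᵁ (D.c k).opensRange) :=
      (isAffineOpen_opensRange (D.c k)).preimage g.imageι
    -- Invariants are known to descend only over a whole chart, and `U` is arbitrary. It is
    -- therefore shrunk to a basic open of the chart, where localization of invariants applies.
    obtain ⟨r, hr, hry⟩ := hU0.exists_basicOpen_le ⟨y, hy⟩ hk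
    refine ⟨g.image.basicOpen r, hr, hry, ?_⟩
    refine exists_app_basicOpen_eq g.toImage τ hcomp e (hU0.preimage g.toImage) ?_ r _ ?_
    · intro s hs
      have hV : g.toImage ⁻¹ᵁ g.imageι ⁻¹ᵁ (D.c k).opensRange = (D.j k).opensRange := by
        rw [← Scheme.Hom.comp_preimage, Scheme.Hom.toImage_imageι, D.preimage_c]
      obtain ⟨t, ht⟩ := exists_appLE_eq_of_chart g τ (D.c k) (D.j k) (D.ψ k) (D.σ k) (D.j_g k)
        (D.j_τ k) (D.invariants k) rfl hV
        (by rw [← Scheme.Hom.comp_preimage, Scheme.Hom.toImage_imageι]) (e _) s hs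
      refine ⟨g.imageι.app _ t, ?_⟩
      rw [← ht, ← CommRingCat.comp_apply, ← Scheme.Hom.comp_app, Scheme.Hom.app_eq_appLE]
      simp only [Scheme.Hom.toImage_imageι]
      rfl
    · rw [← CommRingCat.comp_apply, Scheme.Hom.map_appLE]
      conv_rhs => rw [← hs]
      rw [← CommRingCat.comp_apply, Scheme.Hom.appLE_map]
  · rintro ⟨t, rfl, -⟩
    rw [Scheme.Hom.app_eq_appLE, ← CommRingCat.comp_apply, Scheme.Hom.appLE_comp_appLE]
    simp only [hcomp]

end InvolutionCharts

end AlgebraicGeometry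

/-! ### Restriction and universal property of the quotient -/

namespace TodorovFamily.IsInvolutionQuotient

variable {X Y : Scheme.{0}} {τ : X ⟶ X} {π : X ⟶ Y}

theorem appLE_eq_iff (h : IsInvolutionQuotient τ π) {U : Y.Opens} {V : X.Opens} (hV : V = π ⁻¹ᵁ U)
    (e : V ≤ τ ⁻¹ᵁ V) (e' : V ≤ π ⁻¹ᵁ U) (s : Γ(X, V)) :
    τ.appLE V V e s = s ↔ ∃! t : Γ(Y, U), π.appLE U V e' t = s := by
  subst hV
  rw [← Scheme.Hom.app_eq_appLE]
  exact h.functions U s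

/-- The restriction of a quotient by an involution to an open subset of the quotient. -/
theorem resLE (h : IsInvolutionQuotient τ π) {O : Y.Opens} {V : X.Opens} (hV : V = π ⁻¹ᵁ O)
    (e : V ≤ τ ⁻¹ᵁ V) (e' : V ≤ π ⁻¹ᵁ O) :
    IsInvolutionQuotient (τ.resLE V V e) (π.resLE O V e') := by
  subst hV
  refine ⟨?_, ?_, fun x y => ?_, fun U s => ?_⟩
  · rw [Scheme.Hom.resLE_comp_resLE]
    simp only [h.comp_eq]
  · rw [Scheme.Hom.resLE_eq_morphismRestrict, morphismRestrict_base]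
    exact h.isQuotientMap.restrictPreimage_isOpen O.2
  · have h1 := Scheme.Hom.coe_resLE_apply π e' x
    have h2 := Scheme.Hom.coe_resLE_apply π e' y
    have h3 := Scheme.Hom.coe_resLE_apply τ e x
    exact (Subtype.ext_iff.trans (by rw [h1, h2])).trans ((h.fiber x.1 y.1).trans
      (or_congr Subtype.ext_iff.symm ((Subtype.ext_iff.trans (by rw [h3])).symm)))
  · simp only [Scheme.Hom.app_eq_appLE, Scheme.Hom.resLE_appLE]
    apply h.appLE_eq_iff
    ext x
    constructor
    · rintro ⟨z, hz, rfl⟩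
      refine ⟨_, hz, ?_⟩
      exact Scheme.Hom.coe_resLE_apply ..
    · rintro ⟨z, hz, hzx⟩
      have hx : x ∈ π ⁻¹ᵁ O := by
        change π x ∈ O
        rw [← hzx]; exact z.2
      refine ⟨⟨x, hx⟩, ?_, rfl⟩
      change (π.resLE O _ e') ⟨x, hx⟩ ∈ U
      have hzx' : (π.resLE O _ e') ⟨x, hx⟩ = z :=
        Subtype.ext ((Scheme.Hom.coe_resLE_apply π e' ⟨x, hx⟩).trans hzx.symm)
      rw [hzx']
      exact hz

theorem appTop_eq_iff (h : IsInvolutionQuotient τ π) (s : Γ(X, ⊤)) :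
    τ.appTop s = s ↔ ∃! t : Γ(Y, ⊤), π.appTop t = s := by
  have := h.appLE_eq_iff (U := ⊤) (V := ⊤) rfl le_rfl le_rfl s
  have h1 : τ.appLE ⊤ ⊤ le_rfl = τ.appTop := τ.appLE_eq_app
  have h2 : π.appLE ⊤ ⊤ le_rfl = π.appTop := π.appLE_eq_app
  rwa [h1, h2] at this

theorem appTop_injective (h : IsInvolutionQuotient τ π) : Function.Injective π.appTop := by
  intro a b hab
  refine ((h.appTop_eq_iff (π.appTop a)).mp ?_).unique rfl hab.symm
  rw [← CommRingCat.comp_apply, ← Scheme.Hom.comp_appTop, h.comp_eq]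

end TodorovFamily.IsInvolutionQuotient

/-- Preimages under an injective map are unique, so choosing them elementwise respects the ring
operations. -/
theorem CommRingCat.exists_comp_eq_of_injective {A B C : CommRingCat.{0}} (f : A ⟶ C) (g : B ⟶ C)
    (hg : Function.Injective g) (h : ∀ a, ∃ b, g b = f a) : ∃ φ : A ⟶ B, φ ≫ g = f := by
  choose φ hφ using h
  refine ⟨CommRingCat.ofHom ⟨⟨⟨φ, ?_⟩, ?_⟩, ?_, ?_⟩, ?_⟩
  · exact hg (by rw [hφ, map_one, map_one])
  · exact fun a b => hg (by rw [hφ, map_mul, map_mul, ← hφ, ← hφ])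
  · exact hg (by rw [hφ, map_zero, map_zero])
  · exact fun a b => hg (by rw [map_add]; exact (hφ _).trans (by rw [map_add, ← hφ, ← hφ]))
  · ext a
    exact hφ a

namespace TodorovFamily.IsInvolutionQuotient

variable {X Y : Scheme.{0}} {τ : X ⟶ X} {π : X ⟶ Y}

/-- A morphism to an affine scheme that is invariant under the involution factors through the
quotient. -/
theorem exists_comp_eq (h : IsInvolutionQuotient τ π) {R : CommRingCat.{0}} (f : X ⟶ Spec R)
    (hf : τ ≫ f = f) : ∃ p : Y ⟶ Spec R, π ≫ p = f := by
  -- A morphism to an affine scheme is a ring map to global sections. Invariance of `f` puts its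
  -- values among the invariant functions, which are the functions on the quotient.
  obtain ⟨φ, hφ⟩ := CommRingCat.exists_comp_eq_of_injective f.appTop π.appTop h.appTop_injective
    fun r => ((h.appTop_eq_iff (f.appTop r)).mp (by
      rw [← CommRingCat.comp_apply, ← Scheme.Hom.comp_appTop, hf])).exists
  refine ⟨Y.toSpecΓ ≫ Spec.map φ ≫ (Spec R).isoSpec.inv, ?_⟩
  rw [← Category.assoc, ← Category.assoc, Iso.comp_inv_eq, Scheme.toSpecΓ_naturality,
    Category.assoc, ← Spec.map_comp, hφ]
  exact (Scheme.toSpecΓ_naturality f).symm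

/-- Morphisms from the quotient to an affine scheme are determined by their composition with the
quotient morphism. -/
theorem hom_ext (h : IsInvolutionQuotient τ π) {R : CommRingCat.{0}} {p q : Y ⟶ Spec R}
    (hpq : π ≫ p = π ≫ q) : p = q := by
  have h1 : p.appTop = q.appTop := by
    ext a
    apply h.appTop_injective
    rw [← CommRingCat.comp_apply, ← CommRingCat.comp_apply, ← Scheme.Hom.comp_appTop,
      ← Scheme.Hom.comp_appTop, hpq]
  exact ext_of_isAffine h1

end TodorovFamily.IsInvolutionQuotient

/-! ### Invariants of sign changes on polynomial rings -/

namespace MvPolynomial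

variable {ι : Type*} {N : Set ι} {σ : MvPolynomial ι ℂ →+* MvPolynomial ι ℂ}

/-- The invariants of a sign change of some of the variables are generated by the fixed variables
and the products of two variables that change their signs. -/
theorem mem_of_signChange_eq (hC : ∀ a, σ (C a) = C a) (hN : ∀ i ∈ N, σ (X i) = -X i)
    (hN' : ∀ i ∉ N, σ (X i) = X i) (S : Subring (MvPolynomial ι ℂ)) (hSC : ∀ a, C a ∈ S)
    (hS : ∀ i ∈ N, ∀ j ∈ N, X i * X j ∈ S) (hS' : ∀ i ∉ N, X i ∈ S) {p : MvPolynomial ι ℂ}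
    (hp : σ p = p) : p ∈ S := by
  -- Here `s` is the even part and `t` the odd part. The condition `X i * t ∈ S` for all negated `X
  -- i` carries the induction: multiplication by a negated variable exchanges the two parts.
  have key : ∀ p : MvPolynomial ι ℂ, ∃ s t, p = s + t ∧ s ∈ S ∧ σ s = s ∧ σ t = -t ∧
      ∀ i ∈ N, X i * t ∈ S := by
    intro p
    induction p using MvPolynomial.induction_on with
    | C a => exact ⟨C a, 0, by simp, hSC a, hC a, by simp, by simp⟩
    | add p q hp hq =>
      obtain ⟨s, t, rfl, h1, h2, h3, h4⟩ := hp
      obtain ⟨s', t', rfl, h1', h2', h3', h4'⟩ := hq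
      refine ⟨s + s', t + t', by ring, add_mem h1 h1', by rw [map_add, h2, h2'],
        by rw [map_add, h3, h3']; ring, fun i hi => ?_⟩
      rw [mul_add]
      exact add_mem (h4 i hi) (h4' i hi)
    | mul_X p j hp =>
      obtain ⟨s, t, rfl, h1, h2, h3, h4⟩ := hp
      by_cases hj : j ∈ N
      · refine ⟨X j * t, X j * s, by ring, h4 j hj, by rw [map_mul, h3, hN j hj]; ring,
          by rw [map_mul, h2, hN j hj]; ring, fun i hi => ?_⟩
        rw [← mul_assoc]
        exact mul_mem (hS i hi j hj) h1
      · refine ⟨X j * s, X j * t, by ring, mul_mem (hS' j hj) h1,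
          by rw [map_mul, h2, hN' j hj], by rw [map_mul, h3, hN' j hj]; ring, fun i hi => ?_⟩
        rw [mul_left_comm]
        exact mul_mem (hS' j hj) (h4 i hi)
  obtain ⟨s, t, rfl, h1, h2, h3, -⟩ := key p
  rw [map_add, h2, h3, add_right_inj] at hp
  rw [self_eq_neg.mp hp.symm, add_zero]
  exact h1

/-- Injectivity of a monomial substitution. -/
theorem injective_of_monomial {κ : Type*} (f : MvPolynomial ι ℂ →+* MvPolynomial κ ℂ)
    (hC : ∀ a, f (C a) = C a) (m : ι → κ →₀ ℕ) (hf : ∀ i, f (X i) = monomial (m i) 1)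
    (hm : Function.Injective (Finsupp.linearCombination ℕ m)) : Function.Injective f := by
  classical
  have h1 : ∀ e a, f (monomial e a) = monomial (Finsupp.linearCombination ℕ m e) a := by
    intro e a
    rw [monomial_eq, map_mul, hC, Finsupp.prod, map_prod, Finsupp.linearCombination_apply,
      monomial_finsupp_sum_index]
    congr 1
    refine Finset.prod_congr rfl fun j _ => ?_
    rw [map_pow, hf, monomial_pow, one_pow]
  -- Distinct monomials have distinct images, so no cancellation occurs and each coefficient of `p`
  -- can be read off from `f p`.
  have h2 : ∀ p e, coeff (Finsupp.linearCombination ℕ m e) (f p) = coeff e p := by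
    intro p e
    induction p using MvPolynomial.induction_on' with
    | monomial u a => rw [h1, coeff_monomial, coeff_monomial]; simp only [hm.eq_iff]
    | add p q hp hq => rw [map_add, coeff_add, coeff_add, hp, hq]
  intro p q hpq
  ext e
  rw [← h2, ← h2, hpq]

/-- The exponents of the monomial substitution `X i ↦ X i ^ 2`, `X j ↦ X j * X i` for the other
`j ∈ N`. -/
def blowupExponent (N : Set ι) (i : ι) (j : ι) : ι →₀ ℕ :=
  open scoped Classical in
  Finsupp.single j 1 + if j ∈ N then Finsupp.single i 1 else 0

/-- The exponents other than the one of `X i` are unchanged. Once they agree, the exponent of `X i`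
is twice the old one plus a common contribution. -/
theorem blowupExponent_injective (N : Set ι) {i : ι} (hi : i ∈ N) :
    Function.Injective (Finsupp.linearCombination ℕ (blowupExponent N i)) := by
  classical
  have h1 : ∀ e j, j ≠ i → Finsupp.linearCombination ℕ (blowupExponent N i) e j = e j := by
    intro e j hj
    induction e using Finsupp.induction_linear with
    | zero => simp
    | add e e' h h' => simp [h, h']
    | single l n =>
      rw [Finsupp.linearCombination_single, blowupExponent]
      split_ifs <;> simp [Finsupp.single_apply, hj.symm]
  intro e e' h
  have h2 : e.erase i = e'.erase i := by
    ext j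
    by_cases hj : j = i
    · simp [hj]
    · rw [Finsupp.erase_ne hj, Finsupp.erase_ne hj, ← h1 e j hj, h, h1 e' j hj]
  rw [← Finsupp.single_add_erase i e, ← Finsupp.single_add_erase i e', map_add, map_add, h2,
    add_left_inj, Finsupp.linearCombination_single, Finsupp.linearCombination_single] at h
  have h3 := DFunLike.congr_fun h i
  simp [blowupExponent, hi] at h3
  rw [← Finsupp.single_add_erase i e, ← Finsupp.single_add_erase i e', h2,
    show e i = e' i by omega]

/-- With `B` the ring of invariants and `v` corresponding to `X i ^ 2`, the localization `B[1/v]` is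
a polynomial ring with one variable inverted. The reason is that an invariant product of negated
variables can be written `X j * X l = (X j * X i) * (X l * X i) / X i ^ 2`. -/
theorem smooth_of_signChange [Finite ι] (hC : ∀ a, σ (C a) = C a) (hN : ∀ i ∈ N, σ (X i) = -X i)
    (hN' : ∀ i ∉ N, σ (X i) = X i) {B L : Type*} [CommRing B] [CommRing L] [Algebra B L]
    (ψ : B →+* MvPolynomial ι ℂ) (hψ : Function.Injective ψ) (hinv : ∀ p, σ p = p ↔ p ∈ ψ.range)
    (c : ℂ →+* B) (hc : ∀ a, ψ (c a) = C a) {i : ι} (hi : i ∈ N) {v : B} (hv : ψ v = X i ^ 2)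
    [IsLocalization.Away v L] : ((algebraMap B L).comp c).Smooth := by
  classical
  have hg : ∀ j, ∃ b, ψ b = monomial (blowupExponent N i j) 1 := by
    intro j
    refine (hinv _).mp ?_
    rw [blowupExponent, ← one_mul (1 : ℂ), ← monomial_mul, map_mul]
    split_ifs with hj
    · change σ (X j) * σ (X i) = X j * X i
      rw [hN j hj, hN i hi]; ring
    · change σ (X j) * σ (monomial 0 1) = X j * _
      rw [hN' j hj]
      exact congrArg _ (hC 1)
  choose b hb using hg
  let h : MvPolynomial ι ℂ →+* B := eval₂Hom c b
  have hhC : ∀ a, h (C a) = c a := fun a => eval₂Hom_C c b a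
  have hhX : ∀ j, h (X j) = b j := fun j => eval₂Hom_X' c b j
  have hbN : ∀ j ∈ N, ψ (b j) = X j * X i := by
    intro j hj
    rw [hb, blowupExponent, if_pos hj, X, X, monomial_mul, mul_one]
  have hbN' : ∀ j ∉ N, ψ (b j) = X j := by
    intro j hj
    rw [hb, blowupExponent, if_neg hj, add_zero]
    rfl
  have hbv : b i = v := hψ (by rw [hbN i hi, hv, sq])
  have hinj : Function.Injective h := by
    refine Function.Injective.of_comp (f := ψ) ?_
    exact injective_of_monomial (ψ.comp h) (fun a => by rw [RingHom.comp_apply, hhC, hc]) _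
      (fun j => by rw [RingHom.comp_apply, hhX, hb]) (blowupExponent_injective N hi)
  -- The elements that enter the image of `h` after multiplication by a power of `v` form a subring,
  -- so it suffices to test the generators of the invariants.
  have hsurj : ∀ x : B, ∃ n p, v ^ n * x = h p := by
    let S : Subring (MvPolynomial ι ℂ) :=
      { carrier := {x | ∃ n p, (X i ^ 2) ^ n * x = ψ (h p)}
        mul_mem' := by
          rintro x y ⟨n, p, hp⟩ ⟨m, q, hq⟩
          exact ⟨n + m, p * q, by rw [map_mul, map_mul, ← hp, ← hq]; ring⟩
        one_mem' := ⟨0, 1, by simp⟩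
        add_mem' := by
          rintro x y ⟨n, p, hp⟩ ⟨m, q, hq⟩
          refine ⟨n + m, X i ^ m * p + X i ^ n * q, ?_⟩
          rw [map_add, map_mul, map_mul, map_add, map_mul, map_mul, ← hp, ← hq, map_pow, map_pow,
            map_pow, map_pow, hhX, hbv, hv]
          ring
        zero_mem' := ⟨0, 0, by simp⟩
        neg_mem' := by
          rintro x ⟨n, p, hp⟩
          exact ⟨n, -p, by rw [map_neg, map_neg, ← hp]; ring⟩ }
    intro x
    obtain ⟨n, p, hp⟩ : ψ x ∈ S := by
      refine mem_of_signChange_eq hC hN hN' S (fun a => ⟨0, C a, by rw [hhC, hc]; ring⟩) ?_ ?_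
        ((hinv _).mpr ⟨x, rfl⟩)
      · intro j hj l hl
        exact ⟨1, X j * X l, by rw [map_mul, map_mul, hhX, hhX, hbN j hj, hbN l hl]; ring⟩
      · intro j hj
        exact ⟨0, X j, by rw [hhX, hbN' j hj]; ring⟩
    exact ⟨n, p, hψ (by rw [map_mul, map_pow, hv, hp])⟩
  let := h.toAlgebra
  let := ((algebraMap B L).comp h).toAlgebra
  have hloc : IsLocalization.Away (X i : MvPolynomial ι ℂ) L := by
    have hα : ∀ p : MvPolynomial ι ℂ, algebraMap (MvPolynomial ι ℂ) L p = algebraMap B L (h p) :=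
      fun p => rfl
    refine ⟨?_, ?_, ?_⟩
    · rintro ⟨_, n, rfl⟩
      rw [hα]
      simp only [map_pow, hhX, hbv]
      exact (IsLocalization.Away.algebraMap_isUnit v).pow n
    · intro z
      obtain ⟨⟨x, ⟨_, n, rfl⟩⟩, hx⟩ := IsLocalization.surj (Submonoid.powers v) z
      obtain ⟨m, p, hp⟩ := hsurj x
      refine ⟨⟨p, ⟨_, n + m, rfl⟩⟩, ?_⟩
      rw [hα, hα, ← hp, map_mul, ← hx]
      simp only [map_pow, hhX, hbv]
      ring
    · intro p q hpq
      rw [hα, hα] at hpq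
      obtain ⟨⟨_, n, rfl⟩, hn⟩ := IsLocalization.exists_of_eq (M := Submonoid.powers v) hpq
      refine ⟨⟨_, n, rfl⟩, hinj ?_⟩
      simpa only [map_mul, map_pow, hhX, hbv] using hn
  have h1 : (algebraMap ℂ (MvPolynomial ι ℂ)).Smooth :=
    (RingHom.smooth_algebraMap).mpr ⟨inferInstance, inferInstance⟩
  have h2 : (algebraMap (MvPolynomial ι ℂ) L).Smooth :=
    (RingHom.smooth_algebraMap).mpr (Algebra.Smooth.of_isLocalization_Away (X i))
  have h3 := h1.comp h2
  convert h3 using 1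
  ext a
  exact congrArg _ (hhC a).symm

end MvPolynomial

/-! ### Weighted homogeneous substitution -/

namespace MvPolynomial

theorem eval₂Hom_eq_mul_pow {ι R S : Type*} [CommRing R] [CommRing S] {w : ι → ℕ} (f : R →+* S)
    {v y : ι → S} {u : S} (h : ∀ i, v i = y i * u ^ w i) {p : MvPolynomial ι R} {n : ℕ}
    (hp : IsWeightedHomogeneous w p n) : eval₂Hom f v p = eval₂Hom f y p * u ^ n := by
  rw [coe_eval₂Hom, coe_eval₂Hom, eval₂_eq, eval₂_eq, Finset.sum_mul]
  refine Finset.sum_congr rfl fun d hd => ?_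
  rw [← hp (mem_support_iff.mp hd), Finsupp.weight_apply, Finsupp.sum, ← Finset.prod_pow_eq_pow_sum,
    mul_assoc, ← Finset.prod_mul_distrib]
  congr 1
  refine Finset.prod_congr rfl fun i _ => ?_
  rw [h, mul_pow, ← pow_mul, smul_eq_mul, mul_comm (w i)]

end MvPolynomial

/-! ### Explicit affine charts of the family and the involution on them -/

namespace TodorovFamily

open MvPolynomial

/-- The coefficients of `c w⁴ + w² q + Q`, listed. -/
def coefficientEquiv : Coefficient ≃ Unit ⊕ Fin 3 ⊕ Fin 5 where
  toFun
    | .c => .inl ()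
    | .q i => .inr (.inl i)
    | .Q i => .inr (.inr i)
  invFun
    | .inl _ => .c
    | .inr (.inl i) => .q i
    | .inr (.inr i) => .Q i
  left_inv := by rintro (_ | _ | _) <;> rfl
  right_inv := by rintro (_ | _ | _) <;> rfl

instance : Fintype Coefficient := Fintype.ofEquiv _ coefficientEquiv.symm

instance : DecidableEq Coefficient := coefficientEquiv.decidableEq

/-- The monomial with a given coefficient in `c w⁴ + w² q(x₁, x₂) + Q(x₁, x₂)`. -/
def formMonomial {S : Type} [CommRing S] (v : Fin 5 → S) : Coefficient → S
  | .c => v 0 ^ 4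
  | .q i => v 0 ^ 2 * (v 1 ^ (2 - (i : ℕ)) * v 2 ^ (i : ℕ))
  | .Q i => v 1 ^ (4 - (i : ℕ)) * v 2 ^ (i : ℕ)

/-- In this form the equation is visibly affine linear in the parameters, which is what permits
solving for one of them. -/
theorem eval₂Hom_equation {R S : Type} [CommRing R] [CommRing S] (ρ : R →+* S) (v : Fin 5 → S)
    (a : Coefficient → R) (j : Fin 5) :
    eval₂Hom ρ v (equation a j) = v j ^ 2 + ∑ m, ρ (a m) * formMonomial v m := by
  rw [← coefficientEquiv.symm.sum_comp, Fintype.sum_sum_type, Fintype.sum_sum_type]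
  simp only [equation, quadraticForm, quarticForm, map_add, map_mul, map_pow, map_sum,
    eval₂Hom_X', eval₂Hom_C, coefficientEquiv, Equiv.coe_fn_symm_mk, formMonomial, Finset.mul_sum,
    Finset.univ_unique, Finset.sum_singleton]
  rw [add_assoc, add_assoc]
  congr 3
  · exact Finset.sum_congr rfl fun i _ => by ring
  · exact Finset.sum_congr rfl fun i _ => by ring

/-- The coordinates of weight 1. -/
def chartVar : Fin 3 → Fin 5 := ![0, 1, 2]

/-- The coefficient of the fourth power of a coordinate of weight 1. -/
def chartCoeff : Fin 3 → Coefficient := ![.c, .Q 0, .Q 4]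

/-- The coordinates of weight 2. -/
def squareVar : Fin 2 → Fin 5 := ![3, 4]

theorem weight_chartVar (κ : Fin 3) : weight (chartVar κ) = 1 := by fin_cases κ <;> rfl

theorem weight_squareVar (l : Fin 2) : weight (squareVar l) = 2 := by fin_cases l <;> rfl

theorem formMonomial_chartCoeff {S : Type} [CommRing S] (v : Fin 5 → S) (κ : Fin 3) :
    formMonomial v (chartCoeff κ) = v (chartVar κ) ^ 4 := by
  fin_cases κ <;> simp [chartCoeff, chartVar, formMonomial]

/-- The coordinates on a chart of the family: the coordinates other than the one that is inverted,
and the parameters other than the coefficients of its fourth power. -/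
abbrev ChartIndex (κ : Fin 3) : Type :=
  {i : Fin 5 // i ≠ chartVar κ} ⊕ {p : Fin 2 × Coefficient // p.2 ≠ chartCoeff κ}

/-- The coordinate ring of a chart of the family. -/
abbrev ChartRing (κ : Fin 3) : Type := MvPolynomial (ChartIndex κ) ℂ

/-- The homogeneous coordinates on a chart. -/
def chartCoord (κ : Fin 3) (i : Fin 5) : ChartRing κ :=
  if h : i = chartVar κ then 1 else X (.inl ⟨i, h⟩)

theorem chartCoord_chartVar (κ : Fin 3) : chartCoord κ (chartVar κ) = 1 := dif_pos rfl

/-- The parameters on a chart. -/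
def chartParam (κ : Fin 3) (p : Fin 2 × Coefficient) : ChartRing κ :=
  if h : p.2 = chartCoeff κ then
    -- The equation with index `p.1`, solved for the coefficient of the monomial that equals 1 on
    -- this chart.
    -(chartCoord κ (squareVar p.1) ^ 2 + ∑ m : {m : Coefficient // m ≠ chartCoeff κ},
      X (.inr ⟨(p.1, m.1), m.2⟩) * formMonomial (chartCoord κ) m.1)
  else X (.inr ⟨p, h⟩)

theorem chartParam_of_ne {κ : Fin 3} {p : Fin 2 × Coefficient} (h : p.2 ≠ chartCoeff κ) :
    chartParam κ p = X (.inr ⟨p, h⟩) := dif_neg h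

theorem chartParam_chartCoeff (κ : Fin 3) (l : Fin 2) : chartParam κ (l, chartCoeff κ) =
    -(chartCoord κ (squareVar l) ^ 2 + ∑ m : {m : Coefficient // m ≠ chartCoeff κ},
      chartParam κ (l, m.1) * formMonomial (chartCoord κ) m.1) := by
  rw [chartParam, dif_pos rfl]
  congr 2
  exact Finset.sum_congr rfl fun m _ => by rw [chartParam_of_ne]

theorem sum_eq_chartCoeff_add {S : Type} [CommRing S] (κ : Fin 3) (f : Coefficient → S) :
    ∑ m, f m = f (chartCoeff κ) + ∑ m : {m : Coefficient // m ≠ chartCoeff κ}, f m.1 := by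
  rw [Fintype.sum_eq_add_sum_compl (chartCoeff κ)]
  congr 1
  exact (Finset.sum_subtype _ (by simp) f)

/-- The projection to the parameter space on a chart. -/
def coeffMap (κ : Fin 3) : ParameterRing →+* ChartRing κ := eval₂Hom C (chartParam κ)

/-- Dehomogenization on a chart of the family. -/
def dehomogenize (κ : Fin 3) : MvPolynomial (Fin 5) ParameterRing →+* ChartRing κ :=
  eval₂Hom (coeffMap κ) (chartCoord κ)

theorem coeffMap_universalPair (κ : Fin 3) (l : Fin 2) (m : Coefficient) :
    coeffMap κ (universalPair l m) = chartParam κ (l, m) := eval₂Hom_X' _ _ _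

theorem dehomogenize_equation (κ : Fin 3) (l : Fin 2) :
    dehomogenize κ (equation (universalPair l) (squareVar l)) = 0 := by
  rw [dehomogenize, eval₂Hom_equation, sum_eq_chartCoeff_add κ, formMonomial_chartCoeff,
    chartCoord_chartVar]
  simp only [coeffMap_universalPair]
  rw [chartParam_chartCoeff]
  ring

theorem dehomogenize_idealFG (κ : Fin 3) {p : MvPolynomial (Fin 5) ParameterRing}
    (hp : p ∈ idealFG universalPair) : dehomogenize κ p = 0 := by
  have h : idealFG universalPair ≤ RingHom.ker (dehomogenize κ) := by
    rw [idealFG, Ideal.span_le]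
    rintro x (rfl | rfl)
    exacts [dehomogenize_equation κ 0, dehomogenize_equation κ 1]
  exact h hp

/-- Dehomogenization of the homogeneous coordinate ring of the family. -/
def dehomogenizeCoord (κ : Fin 3) : CoordRing universalPair →+* ChartRing κ :=
  Ideal.Quotient.lift _ (dehomogenize κ) fun _ => dehomogenize_idealFG κ

/-- The signs of the coordinates under the involution. -/
def sign : Fin 5 → ℤ := ![-1, 1, 1, -1, -1]

theorem sign_sq (i : Fin 5) : sign i ^ 2 = 1 := by fin_cases i <;> rfl

theorem signChange_X {R : Type} [CommRing R] (i : Fin 5) :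
    signChange (X i : MvPolynomial (Fin 5) R) = (sign i : MvPolynomial (Fin 5) R) * X i := by
  rw [signChange, aeval_X]
  fin_cases i <;> simp [sign]

/-- The signs of the coordinates on a chart under the involution. -/
def chartSign (κ : Fin 3) (i : Fin 5) : ℤ := sign i * sign (chartVar κ) ^ weight i

theorem chartSign_sq (κ : Fin 3) (i : Fin 5) : chartSign κ i ^ 2 = 1 := by
  rw [chartSign, mul_pow, ← pow_mul, mul_comm (weight i), pow_mul, sign_sq, sign_sq, one_pow,
    one_mul]

/-- The factor `sign (chartVar κ) ^ weight i` rescales the homogeneous coordinates after the sign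
change so that the inverted one is 1 again. -/
theorem chartSign_chartVar (κ : Fin 3) : chartSign κ (chartVar κ) = 1 := by
  rw [chartSign, weight_chartVar, pow_one, ← sq, sign_sq]

/-- Every monomial is even in `w`, and it has degree 4, so the rescaling by a sign does not affect
it either. -/
theorem formMonomial_chartSign {S : Type} [CommRing S] (κ : Fin 3) (v : Fin 5 → S)
    (m : Coefficient) :
    formMonomial (fun i => (chartSign κ i : S) * v i) m = formMonomial v m := by
  fin_cases κ <;> rcases m with _ | i | i <;> try fin_cases i
  all_goals simp [formMonomial, chartSign, sign, chartVar, weight, Even.neg_pow (by decide : Even 4)]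
  all_goals try ring

/-- The involution on a chart. -/
def chartInvolution (κ : Fin 3) : ChartRing κ →+* ChartRing κ :=
  eval₂Hom C (Sum.elim (fun i => (chartSign κ i.1 : ChartRing κ) * X (.inl i)) fun p => X (.inr p))

theorem chartInvolution_C (κ : Fin 3) (a : ℂ) : chartInvolution κ (C a) = C a := eval₂Hom_C _ _ _

theorem chartInvolution_X_inl (κ : Fin 3) (i) : chartInvolution κ (X (.inl i)) =
    (chartSign κ i.1 : ChartRing κ) * X (.inl i) := eval₂Hom_X' _ _ _

theorem chartInvolution_X_inr (κ : Fin 3) (p) : chartInvolution κ (X (.inr p)) = X (.inr p) :=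
  eval₂Hom_X' _ _ _

theorem chartInvolution_chartCoord (κ : Fin 3) (i : Fin 5) : chartInvolution κ (chartCoord κ i) =
    (chartSign κ i : ChartRing κ) * chartCoord κ i := by
  by_cases h : i = chartVar κ
  · subst h
    simp [chartCoord_chartVar, chartSign_chartVar]
  · rw [chartCoord, dif_neg h, chartInvolution_X_inl]

theorem map_formMonomial {S T : Type} [CommRing S] [CommRing T] (f : S →+* T) (v : Fin 5 → S)
    (m : Coefficient) : f (formMonomial v m) = formMonomial (fun i => f (v i)) m := by
  rcases m with _ | i | i <;> simp [formMonomial]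

theorem chartInvolution_chartParam (κ : Fin 3) (p : Fin 2 × Coefficient) :
    chartInvolution κ (chartParam κ p) = chartParam κ p := by
  have h1 : ∀ p : Fin 2 × Coefficient, p.2 ≠ chartCoeff κ →
      chartInvolution κ (chartParam κ p) = chartParam κ p := fun p hp => by
    rw [chartParam_of_ne hp, chartInvolution_X_inr]
  by_cases h : p.2 = chartCoeff κ
  · obtain ⟨l, m⟩ := p
    obtain rfl : m = chartCoeff κ := h
    rw [chartParam_chartCoeff, map_neg, map_add, map_pow, chartInvolution_chartCoord, mul_pow,
      ← Int.cast_pow, chartSign_sq, Int.cast_one, one_mul, map_sum]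
    congr 2
    refine Finset.sum_congr rfl fun m _ => ?_
    rw [map_mul, h1 _ m.2, map_formMonomial]
    simp only [chartInvolution_chartCoord, formMonomial_chartSign]
  · exact h1 p h

theorem chartInvolution_coeffMap (κ : Fin 3) (r : ParameterRing) :
    chartInvolution κ (coeffMap κ r) = coeffMap κ r := by
  have : (chartInvolution κ).comp (coeffMap κ) = coeffMap κ := by
    refine ringHom_ext (fun a => ?_) fun p => ?_
    · simp only [coeffMap, RingHom.comp_apply, eval₂Hom_C, chartInvolution_C]
    · simp only [coeffMap, RingHom.comp_apply, eval₂Hom_X', chartInvolution_chartParam]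
  exact RingHom.congr_fun this r

theorem chartInvolution_involutive (κ : Fin 3) (p : ChartRing κ) :
    chartInvolution κ (chartInvolution κ p) = p := by
  have : (chartInvolution κ).comp (chartInvolution κ) = RingHom.id _ := by
    refine ringHom_ext (fun a => ?_) fun i => ?_
    · simp [chartInvolution_C]
    · rcases i with i | i
      · simp only [RingHom.comp_apply, chartInvolution_X_inl, map_mul, map_intCast, ← mul_assoc,
          ← sq, ← Int.cast_pow, chartSign_sq, Int.cast_one, one_mul, RingHom.id_apply]
      · simp [chartInvolution_X_inr]
  exact RingHom.congr_fun this p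

/-- The two sides evaluate `p` at coordinates that differ by the weighted rescaling with the sign of
the inverted coordinate, hence by that sign to the power `4 * n`, which is 1. -/
theorem dehomogenize_signChange (κ : Fin 3) {p : MvPolynomial (Fin 5) ParameterRing} {n : ℕ}
    (hp : IsWeightedHomogeneous weight p (4 * n)) :
    dehomogenize κ (signChange p) = chartInvolution κ (dehomogenize κ p) := by
  have h1 : (dehomogenize κ).comp signChange.toRingHom =
      eval₂Hom (coeffMap κ) fun i => (sign i : ChartRing κ) * chartCoord κ i := by
    refine ringHom_ext (fun a => ?_) fun i => ?_
    · change dehomogenize κ (signChange (C a)) = _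
      rw [← algebraMap_eq, AlgHom.commutes, algebraMap_eq, dehomogenize, eval₂Hom_C, eval₂Hom_C]
    · change dehomogenize κ (signChange (X i)) = _
      rw [signChange_X, map_mul, map_intCast, dehomogenize, eval₂Hom_X', eval₂Hom_X']
  have h2 : (chartInvolution κ).comp (dehomogenize κ) =
      eval₂Hom (coeffMap κ) fun i => (chartSign κ i : ChartRing κ) * chartCoord κ i := by
    refine ringHom_ext (fun a => ?_) fun i => ?_
    · rw [RingHom.comp_apply, dehomogenize, eval₂Hom_C, eval₂Hom_C, chartInvolution_coeffMap]
    · rw [RingHom.comp_apply, dehomogenize, eval₂Hom_X', eval₂Hom_X', chartInvolution_chartCoord]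
  refine (RingHom.congr_fun h1 p).trans (Eq.trans ?_ (RingHom.congr_fun h2 p).symm)
  rw [eval₂Hom_eq_mul_pow (coeffMap κ) (u := (sign (chartVar κ) : ChartRing κ)) (fun i => ?_) hp]
  · rw [pow_mul, show (4 : ℕ) = 2 * 2 from rfl, pow_mul, ← Int.cast_pow, sign_sq, Int.cast_one,
      one_pow, one_pow, mul_one]
  · rw [chartSign, Int.cast_mul, Int.cast_pow, mul_right_comm _ (_ : ChartRing κ), mul_assoc (sign i : ChartRing κ),
      ← mul_pow, ← sq, ← Int.cast_pow, sign_sq, Int.cast_one, one_pow, mul_one]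

end TodorovFamily

/-! ### The charts as degree-zero localizations of the coordinate ring -/

namespace HomogeneousLocalization.Away

variable {A σ : Type*} [CommRing A] [SetLike σ A] [AddSubgroupClass σ A] {𝒜 : ℕ → σ}
  [GradedRing 𝒜]

theorem val_mk_mul_pow {f : A} {d : ℕ} (hf : f ∈ 𝒜 d) (n : ℕ) (a : A) (ha : a ∈ 𝒜 (n • d)) :
    (Away.mk 𝒜 hf n a ha).val * algebraMap A (Localization.Away f) f ^ n =
      algebraMap A (Localization.Away f) a := by
  rw [Away.val_mk, Localization.mk_eq_mk', ← map_pow]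
  exact IsLocalization.mk'_spec (Localization.Away f) a (⟨f ^ n, n, rfl⟩ : Submonoid.powers f)

end HomogeneousLocalization.Away

namespace TodorovFamily

open MvPolynomial HomogeneousLocalization

/-- The homogeneous coordinates. -/
def coord (i : Fin 5) : CoordRing universalPair := Ideal.Quotient.mk _ (X i)

theorem coord_mem (i : Fin 5) : coord i ∈ coordGrading universalPair (weight i) :=
  ⟨X i, isWeightedHomogeneous_X _ _ i, rfl⟩

/-- Fourth powers are inverted instead of the coordinates themselves: they are fixed by the sign
change, and they belong to the degree 4 linear systems used later. -/
theorem coord_pow_mem (κ : Fin 3) : coord (chartVar κ) ^ 4 ∈ coordGrading universalPair 4 := by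
  have := SetLike.pow_mem_graded 4 (coord_mem (chartVar κ))
  rwa [weight_chartVar] at this

theorem dehomogenizeCoord_mk (κ : Fin 3) (p : MvPolynomial (Fin 5) ParameterRing) :
    dehomogenizeCoord κ (Ideal.Quotient.mk _ p) = dehomogenize κ p := rfl

theorem dehomogenizeCoord_coord (κ : Fin 3) (i : Fin 5) :
    dehomogenizeCoord κ (coord i) = chartCoord κ i := eval₂Hom_X' _ _ _

theorem dehomogenizeCoord_coord_chartVar (κ : Fin 3) :
    dehomogenizeCoord κ (coord (chartVar κ) ^ 4) = 1 := by
  rw [map_pow, dehomogenizeCoord_coord, chartCoord_chartVar, one_pow]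

/-- The degree 0 part of the homogeneous coordinate ring with a coordinate of weight 1 inverted. -/
abbrev ChartAway (κ : Fin 3) : Type :=
  Away (coordGrading universalPair) (coord (chartVar κ) ^ 4)

/-- The comparison of the degree 0 part of the localized coordinate ring with the coordinate ring of
the chart. -/
def toChartRing (κ : Fin 3) : ChartAway κ →+* ChartRing κ :=
  (IsLocalization.Away.lift (S := Localization.Away (coord (chartVar κ) ^ 4))
    (coord (chartVar κ) ^ 4) (g := dehomogenizeCoord κ)
    (by rw [dehomogenizeCoord_coord_chartVar]; exact isUnit_one)).comp
  (algebraMap (ChartAway κ) (Localization.Away (coord (chartVar κ) ^ 4)))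

theorem toChartRing_mk (κ : Fin 3)
    (x : NumDenSameDeg (coordGrading universalPair) (.powers (coord (chartVar κ) ^ 4))) :
    toChartRing κ (HomogeneousLocalization.mk x) = dehomogenizeCoord κ x.num := by
  obtain ⟨n, hn⟩ := x.den_mem
  rw [toChartRing, RingHom.comp_apply, HomogeneousLocalization.algebraMap_apply, val_mk, Localization.mk_eq_mk']
  rw [IsLocalization.Away.lift, IsLocalization.lift_mk'_spec]
  change _ = dehomogenizeCoord κ x.den * _
  rw [← hn]
  simp only [map_pow]
  rw [← map_pow, dehomogenizeCoord_coord_chartVar, one_pow, one_mul]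

/-- The functions on a chart that come from the parameter space. -/
def coeffAway (κ : Fin 3) : ParameterRing →+* ChartAway κ :=
  (fromZeroRingHom (coordGrading universalPair) _).comp
    (algebraMap ParameterRing (coordGrading universalPair 0))

theorem val_coeffAway (κ : Fin 3) (r : ParameterRing) : (coeffAway κ r).val =
    algebraMap (CoordRing universalPair) (Localization.Away (coord (chartVar κ) ^ 4))
      (Ideal.Quotient.mk _ (C r)) := by
  exact (val_mk _).trans (Localization.mk_one_eq_algebraMap _)

theorem toChartRing_coeffAway (κ : Fin 3) (r : ParameterRing) :
    toChartRing κ (coeffAway κ r) = coeffMap κ r :=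
  (toChartRing_mk κ _).trans (eval₂Hom_C _ _ _)

theorem coord_mul_pow_mem (κ : Fin 3) (i : Fin 5) :
    coord i * coord (chartVar κ) ^ (4 - weight i) ∈ coordGrading universalPair (1 • 4) := by
  have := SetLike.mul_mem_graded (coord_mem i)
    (SetLike.pow_mem_graded (4 - weight i) (coord_mem (chartVar κ)))
  rw [weight_chartVar] at this
  have h : weight i ≤ 4 := by fin_cases i <;> decide
  convert this using 2
  simp; omega

/-- The coordinates on a chart. -/
def coordAway (κ : Fin 3) (i : Fin 5) : ChartAway κ :=
  Away.mk _ (coord_pow_mem κ) 1 _ (coord_mul_pow_mem κ i)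

theorem toChartRing_coordAway (κ : Fin 3) (i : Fin 5) :
    toChartRing κ (coordAway κ i) = chartCoord κ i := by
  refine (toChartRing_mk κ _).trans ?_
  change dehomogenizeCoord κ (coord i * _) = _
  rw [map_mul, map_pow, dehomogenizeCoord_coord, dehomogenizeCoord_coord, chartCoord_chartVar,
    one_pow, mul_one]

/-- The inverse of `TodorovFamily.toChartRing`. -/
def ofChartRing (κ : Fin 3) : ChartRing κ →+* ChartAway κ :=
  eval₂Hom ((coeffAway κ).comp C)
    (Sum.elim (fun i => coordAway κ i.1) fun p => coeffAway κ (X p.1))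

theorem toChartRing_ofChartRing (κ : Fin 3) (p : ChartRing κ) :
    toChartRing κ (ofChartRing κ p) = p := by
  have : (toChartRing κ).comp (ofChartRing κ) = RingHom.id _ := by
    refine ringHom_ext (fun a => ?_) fun i => ?_
    · rw [RingHom.comp_apply, ofChartRing, eval₂Hom_C, RingHom.comp_apply, toChartRing_coeffAway,
        coeffMap, eval₂Hom_C]
      rfl
    · rw [RingHom.comp_apply, ofChartRing, eval₂Hom_X']
      rcases i with i | p
      · rw [Sum.elim_inl, toChartRing_coordAway, chartCoord, dif_neg i.2]
        rfl
      · rw [Sum.elim_inr, toChartRing_coeffAway, coeffMap, eval₂Hom_X', chartParam_of_ne p.2]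
        rfl
  exact RingHom.congr_fun this p

theorem isUnit_coord (κ : Fin 3) : IsUnit (algebraMap (CoordRing universalPair)
    (Localization.Away (coord (chartVar κ) ^ 4)) (coord (chartVar κ))) := by
  have := IsLocalization.Away.algebraMap_isUnit (S := Localization.Away (coord (chartVar κ) ^ 4))
    (coord (chartVar κ) ^ 4)
  rw [map_pow] at this
  exact (isUnit_pow_iff (by norm_num)).mp this

theorem val_coordAway_mul (κ : Fin 3) (i : Fin 5) :
    (coordAway κ i).val * algebraMap (CoordRing universalPair) _ (coord (chartVar κ)) ^ weight i =
      algebraMap (CoordRing universalPair) (Localization.Away (coord (chartVar κ) ^ 4)) (coord i) := by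
  have h : weight i ≤ 4 := by fin_cases i <;> decide
  refine ((isUnit_coord κ).pow (4 - weight i)).mul_right_cancel ?_
  have h1 := Away.val_mk_mul_pow (coord_pow_mem κ) 1 _ (coord_mul_pow_mem κ i)
  rw [pow_one, map_pow, map_mul, map_pow] at h1
  rw [mul_assoc, ← pow_add, Nat.add_sub_cancel' h, coordAway, h1]

/-- Rehomogenization. It gives both the relations between the affine coordinates
(`equation_coordAway`) and the fact that they generate (`ofChartRing_surjective`). -/
theorem eval₂Hom_coordAway_mul (κ : Fin 3) {p : MvPolynomial (Fin 5) ParameterRing} {n : ℕ}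
    (hp : IsWeightedHomogeneous weight p n) :
    eval₂Hom ((algebraMap (ChartAway κ) (Localization.Away (coord (chartVar κ) ^ 4))).comp
        (coeffAway κ)) (fun i => (coordAway κ i).val) p *
        algebraMap (CoordRing universalPair) _ (coord (chartVar κ)) ^ n =
      algebraMap (CoordRing universalPair) (Localization.Away (coord (chartVar κ) ^ 4))
        (Ideal.Quotient.mk _ p) := by
  rw [← eval₂Hom_eq_mul_pow _ (fun i => (val_coordAway_mul κ i).symm) hp]
  rw [← RingHom.comp_apply]
  refine RingHom.congr_fun ?_ p
  refine ringHom_ext (fun a => ?_) fun i => ?_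
  · rw [eval₂Hom_C, RingHom.comp_apply, HomogeneousLocalization.algebraMap_apply, val_coeffAway]
    rfl
  · rw [eval₂Hom_X']
    rfl

theorem coordAway_chartVar (κ : Fin 3) : coordAway κ (chartVar κ) = 1 := by
  apply val_injective
  refine (isUnit_coord κ).mul_right_cancel ?_
  have := val_coordAway_mul κ (chartVar κ)
  rw [weight_chartVar, pow_one] at this
  rw [this, val_one, one_mul]

theorem equation_coordAway (κ : Fin 3) (l : Fin 2) : coordAway κ (squareVar l) ^ 2 +
    ∑ m, coeffAway κ (universalPair l m) * formMonomial (coordAway κ) m = 0 := by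
  rw [← eval₂Hom_equation]
  apply val_injective
  refine ((isUnit_coord κ).pow 4).mul_right_cancel ?_
  rw [val_zero, zero_mul, ← HomogeneousLocalization.algebraMap_apply, ← RingHom.comp_apply]
  have h := eval₂Hom_coordAway_mul κ (equation_homogeneous (universalPair l) (squareVar l)
    (weight_squareVar l))
  rw [Ideal.Quotient.eq_zero_iff_mem.mpr, map_zero] at h
  · rw [← h]
    congr 2
    refine ringHom_ext (fun a => ?_) fun i => ?_
    · simp only [RingHom.comp_apply, eval₂Hom_C]
    · simp only [RingHom.comp_apply, eval₂Hom_X', HomogeneousLocalization.algebraMap_apply]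
  · refine Ideal.subset_span ?_
    fin_cases l
    exacts [Or.inl rfl, Or.inr rfl]

theorem ofChartRing_chartCoord (κ : Fin 3) (i : Fin 5) :
    ofChartRing κ (chartCoord κ i) = coordAway κ i := by
  by_cases h : i = chartVar κ
  · subst h
    rw [chartCoord_chartVar, map_one, coordAway_chartVar]
  · rw [chartCoord, dif_neg h]
    exact eval₂Hom_X' _ _ _

/-- For an eliminated parameter this is where the defining equations of the family enter: they
determine it from the others also in the localized coordinate ring. -/
theorem ofChartRing_chartParam (κ : Fin 3) (p : Fin 2 × Coefficient) :
    ofChartRing κ (chartParam κ p) = coeffAway κ (X p) := by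
  have h1 : ∀ p : Fin 2 × Coefficient, p.2 ≠ chartCoeff κ →
      ofChartRing κ (chartParam κ p) = coeffAway κ (X p) := fun p hp => by
    rw [chartParam_of_ne hp]
    exact eval₂Hom_X' _ _ _
  by_cases h : p.2 = chartCoeff κ
  · obtain ⟨l, m⟩ := p
    obtain rfl : m = chartCoeff κ := h
    have h2 := equation_coordAway κ l
    rw [sum_eq_chartCoeff_add κ, formMonomial_chartCoeff, coordAway_chartVar, one_pow, mul_one,
      add_left_comm] at h2
    rw [chartParam_chartCoeff, map_neg, map_add, map_pow, ofChartRing_chartCoord, map_sum]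
    refine Eq.trans ?_ (eq_neg_of_add_eq_zero_left h2).symm
    congr 2
    refine Finset.sum_congr rfl fun m _ => ?_
    rw [map_mul, h1 _ m.2, map_formMonomial]
    simp only [ofChartRing_chartCoord]
    rfl
  · exact h1 p h

theorem ofChartRing_comp_coeffMap (κ : Fin 3) : (ofChartRing κ).comp (coeffMap κ) = coeffAway κ := by
  refine ringHom_ext (fun a => ?_) fun p => ?_
  · rw [RingHom.comp_apply, coeffMap, eval₂Hom_C]
    exact eval₂Hom_C _ _ _
  · rw [RingHom.comp_apply, coeffMap, eval₂Hom_X', ofChartRing_chartParam]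

/-- The preimage of a fraction is the dehomogenization of its numerator. -/
theorem ofChartRing_surjective (κ : Fin 3) : Function.Surjective (ofChartRing κ) := by
  intro z
  obtain ⟨n, a, ha, rfl⟩ := Away.mk_surjective _ (coord_pow_mem κ) z
  obtain ⟨p, hp, hpa⟩ := id ha
  refine ⟨dehomogenize κ p, val_injective _ ?_⟩
  refine ((isUnit_coord κ).pow (n • 4)).mul_right_cancel ?_
  have h1 := Away.val_mk_mul_pow (coord_pow_mem κ) n a ha
  rw [map_pow, ← pow_mul, mul_comm 4 n] at h1
  rw [smul_eq_mul, h1, ← hpa]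
  refine Eq.trans ?_ (eval₂Hom_coordAway_mul κ hp)
  congr 1
  rw [← HomogeneousLocalization.algebraMap_apply, ← RingHom.comp_apply, ← RingHom.comp_apply]
  refine RingHom.congr_fun ?_ p
  refine ringHom_ext (fun r => ?_) fun i => ?_
  · rw [RingHom.comp_apply, RingHom.comp_apply, dehomogenize, eval₂Hom_C, eval₂Hom_C,
      ← RingHom.comp_apply (ofChartRing κ), ofChartRing_comp_coeffMap]
    rfl
  · rw [RingHom.comp_apply, RingHom.comp_apply, dehomogenize, eval₂Hom_X', eval₂Hom_X',
      ofChartRing_chartCoord]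
    rfl

/-- The charts of the family are affine spaces. -/
def chartEquiv (κ : Fin 3) : ChartAway κ ≃+* ChartRing κ :=
  RingEquiv.ofRingHom (toChartRing κ) (ofChartRing κ)
    (RingHom.ext (toChartRing_ofChartRing κ))
    (RingHom.ext fun z => by
      obtain ⟨p, rfl⟩ := ofChartRing_surjective κ z
      rw [RingHom.comp_apply, toChartRing_ofChartRing, RingHom.id_apply])

end TodorovFamily

/-! ### The charts as an open cover, with the projection and the involution -/

namespace AlgebraicGeometry.Proj

open HomogeneousLocalization

theorem awayι_comp_map_of_eq {A σ : Type} [CommRing A] [SetLike σ A] [AddSubgroupClass σ A]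
    {𝒜 : ℕ → σ} [GradedRing 𝒜] (f : 𝒜 →+*ᵍ 𝒜)
    (hf : HomogeneousIdeal.irrelevant 𝒜 ≤ (HomogeneousIdeal.irrelevant 𝒜).map f) {i : ℕ}
    (hi : 0 < i) {s s' : A} (hs : s ∈ 𝒜 i) (hs' : s' ∈ 𝒜 i) (h : f s = s') :
    awayι 𝒜 s' hs' hi ≫ Proj.map f hf = Spec.map (CommRingCat.ofHom
      (HomogeneousLocalization.map f (powers_le_comap_powers f.toRingHom h))) ≫
      awayι 𝒜 s hs hi := by
  subst h
  exact awayι_comp_map f hf hi s hs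

theorem awayι_projToSpec {R A : Type} [CommRing R] [CommRing A] [Algebra R A]
    (𝒜 : ℕ → Submodule R A) [GradedAlgebra 𝒜] {i : ℕ} (hi : 0 < i) {s : A} (hs : s ∈ 𝒜 i) :
    awayι 𝒜 s hs hi ≫ TodorovFamily.projToSpec 𝒜 = Spec.map (CommRingCat.ofHom
      ((fromZeroRingHom 𝒜 (.powers s)).comp (algebraMap R (𝒜 0)))) := by
  rw [TodorovFamily.projToSpec, awayι_toSpecZero_assoc, ← Spec.map_comp]
  rfl

end AlgebraicGeometry.Proj

namespace TodorovFamily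

open MvPolynomial HomogeneousLocalization

theorem iSup_basicOpen_coord :
    ⨆ i, Proj.basicOpen (coordGrading universalPair) (coord i) = ⊤ := by
  refine Proj.iSup_basicOpen_eq_top' _ _ (fun i => ⟨_, coord_mem i⟩) ?_
  rw [eq_top_iff]
  rintro x -
  obtain ⟨p, rfl⟩ := Ideal.Quotient.mk_surjective x
  induction p using MvPolynomial.induction_on with
  | C r => exact Subalgebra.algebraMap_mem _ (algebraMap ParameterRing (coordGrading universalPair 0) r)
  | add p q hp hq => rw [map_add]; exact add_mem hp hq
  | mul_X p i hp => rw [map_mul]; exact mul_mem hp (Algebra.subset_adjoin ⟨i, rfl⟩)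

theorem equation_coord (l : Fin 2) : coord (squareVar l) ^ 2 +
    ∑ m, (Ideal.Quotient.mk (idealFG universalPair) (C (universalPair l m))) *
      formMonomial coord m = 0 := by
  have h := eval₂Hom_equation ((Ideal.Quotient.mk (idealFG universalPair)).comp C) coord
    (universalPair l) (squareVar l)
  refine h.symm.trans ?_
  have h1 : eval₂Hom ((Ideal.Quotient.mk (idealFG universalPair)).comp C) coord =
      Ideal.Quotient.mk _ := by
    refine ringHom_ext (fun a => ?_) fun i => ?_
    · rw [eval₂Hom_C]; rfl
    · rw [eval₂Hom_X']; rfl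
  rw [h1]
  refine Ideal.Quotient.eq_zero_iff_mem.mpr (Ideal.subset_span ?_)
  fin_cases l
  exacts [Or.inl rfl, Or.inr rfl]

/-- A homogeneous prime containing `w`, `x₁`, `x₂` contains every monomial of the two forms, hence
by the equations the squares of `z₃` and `z₄`. It would then contain all coordinates, which no point
of Proj does. -/
theorem iSup_basicOpen_chartVar :
    ⨆ κ, Proj.basicOpen (coordGrading universalPair) (coord (chartVar κ) ^ 4) = ⊤ := by
  refine top_le_iff.mp fun x hx => TopologicalSpace.Opens.mem_iSup.mpr ?_
  by_contra! H
  simp only [Proj.basicOpen_pow _ _ 4 (by norm_num), Proj.mem_basicOpen, not_not] at H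
  obtain ⟨i, hi⟩ := TopologicalSpace.Opens.mem_iSup.mp (iSup_basicOpen_coord.ge hx)
  have h0 : coord 0 ∈ x.asHomogeneousIdeal.toIdeal := H 0
  have h1 : coord 1 ∈ x.asHomogeneousIdeal.toIdeal := H 1
  have h2 : coord 2 ∈ x.asHomogeneousIdeal.toIdeal := H 2
  have hm : ∀ m, formMonomial coord m ∈ x.asHomogeneousIdeal.toIdeal := by
    rintro (_ | j | j)
    · exact Ideal.pow_mem_of_mem _ h0 _ (by norm_num)
    · exact Ideal.mul_mem_right _ _ (Ideal.pow_mem_of_mem _ h0 _ (by norm_num))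
    · rcases eq_or_ne j 0 with rfl | hj
      · exact Ideal.mul_mem_right _ _ (Ideal.pow_mem_of_mem _ h1 _ (by norm_num))
      · exact Ideal.mul_mem_left _ _ (Ideal.pow_mem_of_mem _ h2 _
          (Nat.pos_of_ne_zero fun h => hj (Fin.ext h)))
  have hsq : ∀ l, coord (squareVar l) ∈ x.asHomogeneousIdeal.toIdeal := fun l => by
    refine x.isPrime.mem_of_pow_mem 2 ?_
    rw [eq_neg_of_add_eq_zero_left (equation_coord l)]
    exact neg_mem (sum_mem fun m _ => Ideal.mul_mem_left _ _ (hm m))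
  have h3 : coord 3 ∈ x.asHomogeneousIdeal.toIdeal := hsq 0
  have h4 : coord 4 ∈ x.asHomogeneousIdeal.toIdeal := hsq 1
  refine hi ?_
  fin_cases i
  exacts [h0, h1, h2, h3, h4]

/-- The charts of the family. -/
def chart (κ : Fin 3) : Spec (.of (ChartRing κ)) ⟶ Proj (coordGrading universalPair) :=
  Spec.map (CommRingCat.ofHom (toChartRing κ)) ≫
    Proj.awayι (coordGrading universalPair) _ (coord_pow_mem κ) (by norm_num)

instance (κ : Fin 3) : IsIso (CommRingCat.ofHom (toChartRing κ)) :=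
  (chartEquiv κ).toCommRingCatIso.isIso_hom

instance (κ : Fin 3) : IsOpenImmersion (chart κ) := by
  unfold chart
  infer_instance

theorem opensRange_chart (κ : Fin 3) : (chart κ).opensRange =
    Proj.basicOpen (coordGrading universalPair) (coord (chartVar κ) ^ 4) := by
  rw [← Proj.opensRange_awayι _ _ (coord_pow_mem κ) (by norm_num)]
  unfold chart
  rw [Scheme.Hom.opensRange_comp_of_isIso]

theorem iSup_opensRange_chart : ⨆ κ, (chart κ).opensRange = ⊤ := by
  simp only [opensRange_chart, iSup_basicOpen_chartVar]

theorem chart_toSpec (κ : Fin 3) : chart κ ≫ projToSpec (coordGrading universalPair) =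
    Spec.map (CommRingCat.ofHom (coeffMap κ)) := by
  rw [chart, Category.assoc]
  rw [Proj.awayι_projToSpec]
  rw [← Spec.map_comp, ← CommRingCat.ofHom_comp]
  congr 2
  exact RingHom.ext (toChartRing_coeffAway κ)

theorem coordInvolution_coord (i : Fin 5) :
    coordInvolution universalPair (coord i) = (sign i : CoordRing universalPair) * coord i := by
  have h : coordInvolution universalPair (coord i) = Ideal.Quotient.mk _ (signChange (X i)) := rfl
  rw [h, signChange_X, map_mul, map_intCast]
  rfl

theorem coordInvolution_coord_pow (κ : Fin 3) :
    coordInvolution universalPair (coord (chartVar κ) ^ 4) = coord (chartVar κ) ^ 4 := by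
  rw [map_pow, coordInvolution_coord, mul_pow, show (4 : ℕ) = 2 * 2 from rfl, pow_mul (Int.cast _),
    ← Int.cast_pow, sign_sq, Int.cast_one, one_pow, one_mul]

theorem dehomogenizeCoord_coordInvolution (κ : Fin 3) {a : CoordRing universalPair} {n : ℕ}
    (ha : a ∈ coordGrading universalPair (4 * n)) :
    dehomogenizeCoord κ (coordInvolution universalPair a) =
      chartInvolution κ (dehomogenizeCoord κ a) := by
  obtain ⟨p, hp, rfl⟩ := ha
  exact dehomogenize_signChange κ hp

theorem chart_involution (κ : Fin 3) : chart κ ≫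
    Proj.map (coordInvolution universalPair) (coordInvolution_irrelevant universalPair) =
    Spec.map (CommRingCat.ofHom (chartInvolution κ)) ≫ chart κ := by
  rw [chart, Category.assoc, ← Spec.map_comp_assoc]
  rw [Proj.awayι_comp_map_of_eq (coordInvolution universalPair) _ _ (coord_pow_mem κ)
    (coord_pow_mem κ) (coordInvolution_coord_pow κ)]
  rw [← Spec.map_comp_assoc, ← CommRingCat.ofHom_comp, ← CommRingCat.ofHom_comp]
  congr 3
  refine RingHom.ext fun z => ?_
  obtain ⟨n, a, ha, rfl⟩ := Away.mk_surjective _ (coord_pow_mem κ) z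
  rw [RingHom.comp_apply, RingHom.comp_apply]
  erw [HomogeneousLocalization.map_mk, toChartRing_mk, toChartRing_mk]
  exact dehomogenizeCoord_coordInvolution κ (n := n) (by rwa [mul_comm])

end TodorovFamily

/-! ### Linear systems of degree 4 and their morphisms to projective space -/

namespace AlgebraicGeometry.Proj

open HomogeneousLocalization

variable {A B σ τ : Type} [CommRing A] [SetLike σ A] [AddSubgroupClass σ A]
  [CommRing B] [SetLike τ B] [AddSubgroupClass τ B]
  {𝒜 : ℕ → σ} {ℬ : ℕ → τ} [GradedRing 𝒜] [GradedRing ℬ]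

theorem awayι_mapScale_of_eq {d : ℕ} (hd : 0 < d) (f : B →+* A)
    (hf : ∀ n, ∀ b ∈ ℬ n, f b ∈ 𝒜 (d * n)) {ι : Type} (t : ι → B) (ht : ∀ i, t i ∈ ℬ 1)
    (hcover : ⨆ i, Proj.basicOpen 𝒜 (f (t i)) = ⊤) (i : ι) {s : A} (h : f (t i) = s)
    (hs : s ∈ 𝒜 d) :
    awayι 𝒜 s hs hd ≫ mapScale hd f hf t ht hcover =
      Spec.map (CommRingCat.ofHom (awayScale f hf h)) ≫ awayι ℬ (t i) (ht i) one_pos := by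
  subst h
  exact awayι_mapScale hd f hf t ht hcover i

end AlgebraicGeometry.Proj

namespace TodorovFamily

open MvPolynomial HomogeneousLocalization

attribute [local instance] MvPolynomial.gradedAlgebra

/-- The affine cover of the family by its charts. -/
def chartCover : (Proj (coordGrading universalPair)).AffineOpenCover where
  I₀ := Fin 3
  X κ := .of (ChartRing κ)
  f κ := chart κ
  idx x := (TopologicalSpace.Opens.mem_iSup.mp
    (iSup_opensRange_chart.ge (Set.mem_univ x))).choose
  covers x := (TopologicalSpace.Opens.mem_iSup.mp
    (iSup_opensRange_chart.ge (Set.mem_univ x))).choose_spec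

theorem hom_ext_chart {Y : Scheme.{0}} {f g : Proj (coordGrading universalPair) ⟶ Y}
    (h : ∀ κ, chart κ ≫ f = chart κ ≫ g) : f = g :=
  chartCover.openCover.hom_ext _ _ h

/-- The constants in the homogeneous coordinate ring. -/
def constCoord : ℂ →+* CoordRing universalPair :=
  (Ideal.Quotient.mk (idealFG universalPair)).comp (C.comp C)

theorem constCoord_mem (a : ℂ) : constCoord a ∈ coordGrading universalPair 0 :=
  ⟨C (C a), isWeightedHomogeneous_C _ _, rfl⟩

theorem dehomogenizeCoord_constCoord (κ : Fin 3) (a : ℂ) :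
    dehomogenizeCoord κ (constCoord a) = C a := by
  change dehomogenize κ (C (C a)) = _
  rw [dehomogenize, eval₂Hom_C, coeffMap, eval₂Hom_C]

theorem coordInvolution_mk (p : MvPolynomial (Fin 5) ParameterRing) :
    coordInvolution universalPair (Ideal.Quotient.mk _ p) = Ideal.Quotient.mk _ (signChange p) :=
  rfl

theorem coordInvolution_mk_C (r : ParameterRing) : coordInvolution universalPair
    (Ideal.Quotient.mk _ (C r)) = Ideal.Quotient.mk _ (C r) := by
  rw [coordInvolution_mk, ← algebraMap_eq, AlgHom.commutes]

theorem coordInvolution_constCoord (a : ℂ) :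
    coordInvolution universalPair (constCoord a) = constCoord a :=
  coordInvolution_mk_C (C a)

theorem X_mem_homogeneousSubmodule {σ : Type} (i : σ) :
    (X i : MvPolynomial σ ℂ) ∈ homogeneousSubmodule σ ℂ 1 := isHomogeneous_X _ _

theorem C_mem_homogeneousSubmodule {σ : Type} (a : ℂ) :
    (C a : MvPolynomial σ ℂ) ∈ homogeneousSubmodule σ ℂ 0 := isHomogeneous_C _ _

/-- A finite family of homogeneous elements of degree 4 of the coordinate ring, containing the
fourth powers of the coordinates of weight 1. -/
structure LinearSystem where
  /-- The dimension. -/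
  n : ℕ
  /-- The elements. -/
  s : Fin (n + 1) → CoordRing universalPair
  mem : ∀ j, s j ∈ coordGrading universalPair 4
  /-- The positions of the fourth powers. -/
  idx : Fin 3 → Fin (n + 1)
  s_idx : ∀ κ, s (idx κ) = coord (chartVar κ) ^ 4

namespace LinearSystem

variable (L : LinearSystem)

/-- The substitution of the elements of a linear system. -/
def subst : MvPolynomial (Fin (L.n + 1)) ℂ →+* CoordRing universalPair :=
  eval₂Hom constCoord L.s

theorem subst_X (j) : L.subst (X j) = L.s j := eval₂Hom_X' _ _ _

theorem subst_C (a) : L.subst (C a) = constCoord a := eval₂Hom_C _ _ _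

theorem subst_mem (n : ℕ) (b : MvPolynomial (Fin (L.n + 1)) ℂ)
    (hb : b ∈ homogeneousSubmodule (Fin (L.n + 1)) ℂ n) :
    L.subst b ∈ coordGrading universalPair (4 * n) := by
  rw [subst, coe_eval₂Hom, eval₂_eq]
  refine sum_mem fun d hd => ?_
  have h1 : ∏ i ∈ d.support, L.s i ^ d i ∈
      coordGrading universalPair (∑ i ∈ d.support, d i • 4) :=
    SetLike.prod_pow_mem_graded _ _ _ _ fun i _ => L.mem i
  have h2 := SetLike.mul_mem_graded (constCoord_mem (coeff d b)) h1
  have h3 : Finsupp.weight 1 d = n := hb (mem_support_iff.mp hd)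
  rw [Finsupp.weight_apply, Finsupp.sum] at h3
  convert h2 using 2
  rw [← h3, zero_add, Finset.mul_sum]
  exact Finset.sum_congr rfl fun i _ => by simp [mul_comm]

theorem iSup_basicOpen : ⨆ κ, Proj.basicOpen (coordGrading universalPair)
    (L.subst (X (L.idx κ))) = ⊤ := by
  simp only [subst_X, s_idx, iSup_basicOpen_chartVar]

/-- The morphism to projective space given by a linear system. -/
def toProjectiveSpace : Proj (coordGrading universalPair) ⟶
    Proj (homogeneousSubmodule (Fin (L.n + 1)) ℂ) :=
  Proj.mapScale (d := 4) (by norm_num) L.subst L.subst_mem (fun κ => X (L.idx κ))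
    (fun κ => X_mem_homogeneousSubmodule _) L.iSup_basicOpen

/-- The ring of a standard chart of projective space. -/
abbrev AwayRing (κ : Fin 3) : Type := Away (homogeneousSubmodule (Fin (L.n + 1)) ℂ) (X (L.idx κ))

/-- The morphism to projective space in the charts. -/
def chartMap (κ : Fin 3) : L.AwayRing κ →+* ChartRing κ :=
  (toChartRing κ).comp
    (awayScale L.subst L.subst_mem ((L.subst_X (L.idx κ)).trans (L.s_idx κ)))

theorem chart_toProjectiveSpace (κ : Fin 3) : chart κ ≫ L.toProjectiveSpace =
    Spec.map (CommRingCat.ofHom (L.chartMap κ)) ≫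
      Proj.awayι (homogeneousSubmodule (Fin (L.n + 1)) ℂ) (X (L.idx κ)) (X_mem_homogeneousSubmodule _)
        one_pos := by
  rw [chart, toProjectiveSpace, Category.assoc, Proj.awayι_mapScale_of_eq _ _ _ _ _ _ κ
    ((L.subst_X (L.idx κ)).trans (L.s_idx κ)) (coord_pow_mem κ), ← Spec.map_comp_assoc]
  rfl

theorem chartMap_mk (κ : Fin 3) (n : ℕ) (b : MvPolynomial (Fin (L.n + 1)) ℂ)
    (hX : X (L.idx κ) ∈ homogeneousSubmodule (Fin (L.n + 1)) ℂ 1)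
    (hb : b ∈ homogeneousSubmodule (Fin (L.n + 1)) ℂ (n • 1)) :
    L.chartMap κ (Away.mk _ hX n b hb) = dehomogenizeCoord κ (L.subst b) := by
  rw [chartMap, RingHom.comp_apply, toChartRing, RingHom.comp_apply,
    HomogeneousLocalization.algebraMap_apply, val_awayScale_mk, Localization.mk_eq_mk',
    IsLocalization.Away.lift, IsLocalization.lift_mk'_spec]
  simp only [map_pow]
  rw [← map_pow, dehomogenizeCoord_coord_chartVar, one_pow, one_mul]

theorem C_mem_range (κ : Fin 3) (a : ℂ) : C a ∈ (L.chartMap κ).range := by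
  refine ⟨Away.mk _ (X_mem_homogeneousSubmodule _) 0 (C a) (C_mem_homogeneousSubmodule _), ?_⟩
  rw [chartMap_mk, subst_C, dehomogenizeCoord_constCoord]

theorem dehomogenizeCoord_mem_range (κ : Fin 3) (j) :
    dehomogenizeCoord κ (L.s j) ∈ (L.chartMap κ).range := by
  refine ⟨Away.mk _ (X_mem_homogeneousSubmodule _) 1 (X j) (X_mem_homogeneousSubmodule _), ?_⟩
  rw [chartMap_mk, subst_X]

theorem toProjectiveSpace_toSpec : L.toProjectiveSpace ≫
    projToSpec (homogeneousSubmodule (Fin (L.n + 1)) ℂ) =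
    projToSpec (coordGrading universalPair) ≫
      Spec.map (CommRingCat.ofHom (algebraMap ℂ ParameterRing)) := by
  refine hom_ext_chart fun κ => ?_
  rw [← Category.assoc, ← Category.assoc, chart_toProjectiveSpace, chart_toSpec, ← Spec.map_comp,
    Category.assoc, Proj.awayι_projToSpec, ← Spec.map_comp, ← CommRingCat.ofHom_comp, ← CommRingCat.ofHom_comp]
  congr 2
  refine RingHom.ext fun a => ?_
  have h1 : fromZeroRingHom (homogeneousSubmodule (Fin (L.n + 1)) ℂ) (.powers (X (L.idx κ)))
      (algebraMap ℂ _ a) = Away.mk _ (X_mem_homogeneousSubmodule _) 0 (C a) (C_mem_homogeneousSubmodule _) := by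
    apply val_injective
    rw [Away.val_mk]
    refine (val_mk _).trans ?_
    congr 1
  rw [RingHom.comp_apply, RingHom.comp_apply, h1, chartMap_mk, subst_C,
    dehomogenizeCoord_constCoord, RingHom.comp_apply]
  exact (eval₂Hom_C _ _ _).symm

/-- The open subset of projective space that is covered by the charts. -/
def target : (Proj (homogeneousSubmodule (Fin (L.n + 1)) ℂ)).Opens :=
  ⨆ κ, Proj.basicOpen _ (X (L.idx κ))

theorem preimage_target : L.toProjectiveSpace ⁻¹ᵁ L.target = ⊤ := by
  rw [target, Scheme.Hom.preimage_iSup, ← L.iSup_basicOpen]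
  refine iSup_congr fun κ => ?_
  exact Proj.mapScale_preimage_basicOpen (d := 4) _ _ _ (fun κ => X (L.idx κ)) _ _ κ

theorem range_toProjectiveSpace : Set.range L.toProjectiveSpace ⊆ Set.range L.target.ι := by
  rintro _ ⟨x, rfl⟩
  rw [Scheme.Opens.range_ι]
  exact L.preimage_target.ge (Set.mem_univ x)

/-- The morphism given by a linear system, with target restricted. -/
def toTarget : Proj (coordGrading universalPair) ⟶ L.target.toScheme :=
  IsOpenImmersion.lift L.target.ι L.toProjectiveSpace L.range_toProjectiveSpace

theorem toTarget_ι : L.toTarget ≫ L.target.ι = L.toProjectiveSpace :=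
  IsOpenImmersion.lift_fac _ _ _

/-- The charts of the target. -/
def targetChart (κ : Fin 3) : Spec (.of (L.AwayRing κ)) ⟶ L.target.toScheme :=
  IsOpenImmersion.lift L.target.ι
    (Proj.awayι (homogeneousSubmodule (Fin (L.n + 1)) ℂ) (X (L.idx κ)) (X_mem_homogeneousSubmodule _)
        one_pos) (by
      rw [Scheme.Opens.range_ι, ← Scheme.Hom.coe_opensRange, Proj.opensRange_awayι]
      exact le_iSup (fun κ => Proj.basicOpen (homogeneousSubmodule (Fin (L.n + 1)) ℂ)
        (X (L.idx κ))) κ)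

theorem targetChart_ι (κ : Fin 3) : L.targetChart κ ≫ L.target.ι =
    Proj.awayι (homogeneousSubmodule (Fin (L.n + 1)) ℂ) (X (L.idx κ)) (X_mem_homogeneousSubmodule _)
        one_pos := IsOpenImmersion.lift_fac _ _ _

instance (κ : Fin 3) : IsOpenImmersion (L.targetChart κ) :=
  have : IsOpenImmersion (L.targetChart κ ≫ L.target.ι) := by
    rw [targetChart_ι]; infer_instance
  .of_comp _ L.target.ι

theorem opensRange_targetChart (κ : Fin 3) : (L.targetChart κ).opensRange =
    L.target.ι ⁻¹ᵁ Proj.basicOpen _ (X (L.idx κ)) := by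
  have h : ∀ z, z ∈ Proj.basicOpen (homogeneousSubmodule (Fin (L.n + 1)) ℂ) (X (L.idx κ)) ↔
      ∃ y, (L.targetChart κ ≫ L.target.ι) y = z := by
    intro z
    rw [← Proj.opensRange_awayι _ _ (X_mem_homogeneousSubmodule _) one_pos, targetChart_ι]
    rfl
  ext x
  constructor
  · rintro ⟨y, rfl⟩
    exact (h _).mpr ⟨y, Scheme.Hom.comp_apply _ _ _⟩
  · intro hx
    obtain ⟨y, hy⟩ := (h _).mp hx
    refine ⟨y, L.target.ι.isOpenEmbedding.injective ?_⟩
    rw [← hy, Scheme.Hom.comp_apply]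

theorem iSup_opensRange_targetChart : ⨆ κ, (L.targetChart κ).opensRange = ⊤ := by
  simp only [opensRange_targetChart, ← Scheme.Hom.preimage_iSup]
  exact Scheme.Opens.ι_preimage_self _

theorem chart_toTarget (κ : Fin 3) : chart κ ≫ L.toTarget =
    Spec.map (CommRingCat.ofHom (L.chartMap κ)) ≫ L.targetChart κ := by
  rw [← cancel_mono L.target.ι, Category.assoc, toTarget_ι, chart_toProjectiveSpace,
    Category.assoc, targetChart_ι]

theorem preimage_opensRange_targetChart (κ : Fin 3) :
    L.toTarget ⁻¹ᵁ (L.targetChart κ).opensRange = (chart κ).opensRange := by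
  rw [opensRange_targetChart, ← Scheme.Hom.comp_preimage, toTarget_ι, opensRange_chart,
    ← L.s_idx κ, ← L.subst_X]
  exact Proj.mapScale_preimage_basicOpen (d := 4) _ _ _ (fun κ => X (L.idx κ)) _ _ κ

/-- The preimage of each standard open of `L.target` is the corresponding chart, so the condition
can be checked on rings. The image is closed only in the open subset `L.target`, which is enough for
an immersion into projective space. -/
theorem isClosedImmersion_toTarget (h : ∀ κ, Function.Surjective (L.chartMap κ)) :
    IsClosedImmersion L.toTarget :=
  of_isPullback_charts (Q := @IsClosedImmersion) L.targetChart L.iSup_opensRange_targetChart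
    (fun κ => IsOpenImmersion.isPullback _ (chart κ) (L.targetChart κ) L.toTarget
      (L.chart_toTarget κ) (L.preimage_opensRange_targetChart κ))
    fun κ => IsClosedImmersion.spec_of_surjective _ (h κ)

/-- If the elements of the linear system are invariant and generate the invariants on the charts,
then the charts exhibit the morphism as a quotient. -/
def involutionCharts (h : ∀ κ a, chartInvolution κ a = a → a ∈ (L.chartMap κ).range) :
    InvolutionCharts L.toTarget
      (Proj.map (coordInvolution universalPair) (coordInvolution_irrelevant universalPair)) where
  K := Fin 3
  C κ := .of (L.AwayRing κ)
  P κ := .of (ChartRing κ)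
  c := L.targetChart
  j := chart
  ψ κ := CommRingCat.ofHom (L.chartMap κ)
  σ κ := CommRingCat.ofHom (chartInvolution κ)
  isOpenImmersion_c := inferInstance
  isOpenImmersion_j := inferInstance
  iSup_c := L.iSup_opensRange_targetChart
  j_g := L.chart_toTarget
  preimage_c := L.preimage_opensRange_targetChart
  j_τ := chart_involution
  σ_σ := chartInvolution_involutive
  invariants := h

theorem chartInvolution_chartMap (h : ∀ j, coordInvolution universalPair (L.s j) = L.s j)
    (κ : Fin 3) (a : L.AwayRing κ) : chartInvolution κ (L.chartMap κ a) = L.chartMap κ a := by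
  obtain ⟨n, b, hb, rfl⟩ := Away.mk_surjective _ (X_mem_homogeneousSubmodule _) a
  rw [chartMap_mk, ← dehomogenizeCoord_coordInvolution κ (L.subst_mem _ _ hb)]
  have h1 : (coordInvolution universalPair).toRingHom.comp L.subst = L.subst := by
    refine ringHom_ext (fun a => ?_) fun j => ?_
    · rw [RingHom.comp_apply, subst_C]
      exact coordInvolution_constCoord a
    · rw [RingHom.comp_apply, subst_X]
      exact h j
  exact congrArg _ (RingHom.congr_fun h1 b)

theorem involution_toTarget (h : ∀ j, coordInvolution universalPair (L.s j) = L.s j) :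
    Proj.map (coordInvolution universalPair) (coordInvolution_irrelevant universalPair) ≫
      L.toTarget = L.toTarget := by
  refine hom_ext_chart fun κ => ?_
  rw [← Category.assoc, chart_involution, Category.assoc, chart_toTarget, ← Spec.map_comp_assoc,
    ← CommRingCat.ofHom_comp]
  congr 3
  exact RingHom.ext (L.chartInvolution_chartMap h κ)

end LinearSystem

end TodorovFamily

/-! ### Monomial sections that embed the family and its quotient -/

namespace TodorovFamily

open MvPolynomial

attribute [local instance] MvPolynomial.gradedAlgebra

/-- The indices of the monomials of degree 4 that are used to embed the family and its quotient. -/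
abbrev SectionIndex : Type := Option (Fin 2 × Coefficient) × Fin 5 × Fin 5 × Fin 3

/-- A parameter or `1`, in the coordinate ring. -/
def paramCoord : Option (Fin 2 × Coefficient) → CoordRing universalPair
  | none => 1
  | some p => Ideal.Quotient.mk _ (C (X p))

/-- The monomials of degree 4 that are used to embed the family and its quotient. -/
def sectionCoord (x : SectionIndex) : CoordRing universalPair :=
  paramCoord x.1 * (coord x.2.1 * coord x.2.2.1 *
    coord (chartVar x.2.2.2) ^ (4 - weight x.2.1 - weight x.2.2.1))

theorem paramCoord_mem (o) : paramCoord o ∈ coordGrading universalPair 0 := by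
  rcases o with _ | p
  · exact SetLike.GradedOne.one_mem
  · exact ⟨C (X p), isWeightedHomogeneous_C _ _, rfl⟩

theorem sectionCoord_mem (x : SectionIndex) : sectionCoord x ∈ coordGrading universalPair 4 := by
  obtain ⟨o, i, j, κ⟩ := x
  have := SetLike.mul_mem_graded (paramCoord_mem o) (SetLike.mul_mem_graded
    (SetLike.mul_mem_graded (coord_mem i) (coord_mem j))
    (SetLike.pow_mem_graded (4 - weight i - weight j) (coord_mem (chartVar κ))))
  rw [weight_chartVar] at this
  -- Weights are at most 2, so the truncated subtraction is exact. Degree 4 is just enough for the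
  -- products of two coordinates of weight 2.
  have h : ∀ i j, weight i + weight j + (4 - weight i - weight j) = 4 := by decide
  rwa [smul_eq_mul, mul_one, zero_add, h] at this

theorem sectionCoord_chartVar (κ : Fin 3) :
    sectionCoord (none, chartVar κ, chartVar κ, κ) = coord (chartVar κ) ^ 4 := by
  simp only [sectionCoord, weight_chartVar, paramCoord]
  ring

theorem coordInvolution_paramCoord (o) :
    coordInvolution universalPair (paramCoord o) = paramCoord o := by
  rcases o with _ | p
  · exact map_one _
  · exact coordInvolution_mk_C _

theorem coordInvolution_sectionCoord (o i j κ) :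
    coordInvolution universalPair (sectionCoord (o, i, j, κ)) =
      ((chartSign κ i * chartSign κ j : ℤ) : CoordRing universalPair) *
        sectionCoord (o, i, j, κ) := by
  have h : ∀ κ i j, sign i * sign j * sign (chartVar κ) ^ (4 - weight i - weight j) =
      chartSign κ i * chartSign κ j := by decide
  rw [← h]
  simp only [sectionCoord, map_mul, map_pow, coordInvolution_paramCoord, coordInvolution_coord]
  push_cast
  ring

theorem dehomogenizeCoord_sectionCoord (o i j κ) :
    dehomogenizeCoord κ (sectionCoord (o, i, j, κ)) =
      dehomogenizeCoord κ (paramCoord o) * (chartCoord κ i * chartCoord κ j) := by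
  simp only [sectionCoord, map_mul, map_pow, dehomogenizeCoord_coord, chartCoord_chartVar, one_pow,
    mul_one]

theorem dehomogenizeCoord_paramCoord (κ : Fin 3) (p : Fin 2 × Coefficient) :
    dehomogenizeCoord κ (paramCoord (some p)) = chartParam κ p := by
  rw [paramCoord, dehomogenizeCoord_mk, dehomogenize, eval₂Hom_C, coeffMap, eval₂Hom_X']

/-- The linear system spanned by some of the monomials. -/
def monomialSystem (P : SectionIndex → Prop) (hP : ∀ κ, P (none, chartVar κ, chartVar κ, κ)) :
    LinearSystem :=
  -- A system of dimension `n` has `n + 1` members; nonemptiness makes `Nat.card - 1` the right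
  -- dimension.
  have : Nonempty {x // P x} := ⟨⟨_, hP 0⟩⟩
  have h : Nat.card {x // P x} - 1 + 1 = Nat.card {x // P x} := Nat.sub_add_cancel Nat.card_pos
  { n := Nat.card {x // P x} - 1
    s := fun j => sectionCoord ((Finite.equivFin _).symm (j.cast h)).1
    mem := fun _ => sectionCoord_mem _
    idx := fun κ => (Finite.equivFin {x // P x} ⟨_, hP κ⟩).cast h.symm
    s_idx := fun κ => by
      rw [Fin.cast_cast, Fin.cast_eq_self, Equiv.symm_apply_apply, sectionCoord_chartVar] }

theorem monomialSystem_s (P : SectionIndex → Prop) (hP) (j) :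
    ∃ x, P x ∧ (monomialSystem P hP).s j = sectionCoord x := ⟨_, Subtype.prop _, rfl⟩

theorem mem_range_monomialSystem (P : SectionIndex → Prop) (hP) (κ : Fin 3) {x : SectionIndex}
    (hx : P x) : dehomogenizeCoord κ (sectionCoord x) ∈
      ((monomialSystem P hP).chartMap κ).range := by
  have : Nonempty {x // P x} := ⟨⟨_, hP 0⟩⟩
  have h : Nat.card {x // P x} - 1 + 1 = Nat.card {x // P x} := Nat.sub_add_cancel Nat.card_pos
  have h1 : (monomialSystem P hP).s ((Finite.equivFin {x // P x} ⟨_, hx⟩).cast h.symm) =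
      sectionCoord x := by
    change sectionCoord ((Finite.equivFin _).symm (Fin.cast h (Fin.cast _ _))).1 = _
    rw [Fin.cast_cast, Fin.cast_eq_self, Equiv.symm_apply_apply]
  rw [← h1]
  exact LinearSystem.dehomogenizeCoord_mem_range _ _ _

/-- The linear system that embeds the family. -/
def totalSystem : LinearSystem := monomialSystem (fun _ => True) fun _ => trivial

/-- Each variable of the chart is itself a dehomogenized section: filling up the degree with the
inverted coordinate has no effect where that coordinate is 1. -/
theorem totalSystem_surjective (κ : Fin 3) : Function.Surjective (totalSystem.chartMap κ) := by
  rw [← RingHom.range_eq_top, eq_top_iff]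
  rintro p -
  have h : ∀ x, dehomogenizeCoord κ (sectionCoord x) ∈ (totalSystem.chartMap κ).range :=
    fun x => mem_range_monomialSystem _ _ κ trivial
  induction p using MvPolynomial.induction_on with
  | C a => exact LinearSystem.C_mem_range _ κ a
  | add p q hp hq => exact add_mem hp hq
  | mul_X p i hp =>
    refine mul_mem hp ?_
    rcases i with i | p
    · have := h (none, i.1, chartVar κ, κ)
      rwa [dehomogenizeCoord_sectionCoord, paramCoord, map_one, one_mul, chartCoord_chartVar,
        mul_one, chartCoord, dif_neg i.2] at this
    · have := h (some p.1, chartVar κ, chartVar κ, κ)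
      rwa [dehomogenizeCoord_sectionCoord, chartCoord_chartVar, mul_one, mul_one,
        dehomogenizeCoord_paramCoord, chartParam_of_ne p.2] at this

/-- The linear system that embeds the quotient of the family. -/
def invariantSystem : LinearSystem :=
  monomialSystem (fun x => coordInvolution universalPair (sectionCoord x) = sectionCoord x)
    fun κ => by rw [coordInvolution_sectionCoord, chartSign_chartVar, mul_one, Int.cast_one, one_mul]

theorem coordInvolution_invariantSystem (j) :
    coordInvolution universalPair (invariantSystem.s j) = invariantSystem.s j := by
  obtain ⟨x, hx, h⟩ := monomialSystem_s (fun x => coordInvolution universalPair (sectionCoord x) =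
    sectionCoord x) _ j
  exact (congrArg _ h).trans (hx.trans h.symm)

/-- The coordinates on a chart that change their sign under the involution. -/
def negated (κ : Fin 3) : Set (ChartIndex κ) := {x | ∃ i, x = .inl i ∧ chartSign κ i.1 = -1}

theorem chartInvolution_of_mem {κ : Fin 3} {x : ChartIndex κ} (hx : x ∈ negated κ) :
    chartInvolution κ (X x) = -X x := by
  obtain ⟨i, rfl, hi⟩ := hx
  rw [chartInvolution_X_inl, hi]
  simp

theorem chartSign_eq_one {κ : Fin 3} {i} (hi : .inl i ∉ negated κ) : chartSign κ i.1 = 1 :=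
  (mul_self_eq_one_iff.mp ((sq _).symm.trans (chartSign_sq κ i.1))).resolve_right
    fun h => hi ⟨i, rfl, h⟩

theorem chartInvolution_of_notMem {κ : Fin 3} {x : ChartIndex κ} (hx : x ∉ negated κ) :
    chartInvolution κ (X x) = X x := by
  rcases x with i | p
  · rw [chartInvolution_X_inl, chartSign_eq_one hx, Int.cast_one, one_mul]
  · exact chartInvolution_X_inr κ p

/-- The invariants of a sign change are generated by the fixed variables and the products of two
negated ones. All of these are dehomogenizations of invariant sections, which is why sections with
two coordinate factors were allowed. -/
theorem mem_range_invariantSystem (κ : Fin 3) (a : ChartRing κ) (ha : chartInvolution κ a = a) :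
    a ∈ (invariantSystem.chartMap κ).range := by
  have h : ∀ o i j, chartSign κ i * chartSign κ j = 1 →
      dehomogenizeCoord κ (sectionCoord (o, i, j, κ)) ∈ (invariantSystem.chartMap κ).range :=
    fun o i j hij => mem_range_monomialSystem _ _ κ (by
      rw [coordInvolution_sectionCoord, hij, Int.cast_one, one_mul])
  refine mem_of_signChange_eq (chartInvolution_C κ) (fun _ => chartInvolution_of_mem)
    (fun _ => chartInvolution_of_notMem) _ (LinearSystem.C_mem_range _ κ) ?_ ?_ ha
  · rintro _ ⟨i, rfl, hi⟩ _ ⟨j, rfl, hj⟩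
    have := h none i j (by rw [hi, hj]; norm_num)
    rwa [dehomogenizeCoord_sectionCoord, paramCoord, map_one, one_mul, chartCoord, dif_neg i.2,
      chartCoord, dif_neg j.2] at this
  · rintro (i | p) hx
    · have := h none i (chartVar κ) (by rw [chartSign_eq_one hx, chartSign_chartVar, one_mul])
      rwa [dehomogenizeCoord_sectionCoord, paramCoord, map_one, one_mul, chartCoord_chartVar,
        mul_one, chartCoord, dif_neg i.2] at this
    · have := h (some p.1) (chartVar κ) (chartVar κ) (by rw [chartSign_chartVar, one_mul])
      rwa [dehomogenizeCoord_sectionCoord, chartCoord_chartVar, mul_one, mul_one,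
        dehomogenizeCoord_paramCoord, chartParam_of_ne p.2] at this

end TodorovFamily

/-! ### Absence of fixed points over the admissible parameters -/

namespace TodorovFamily

open MvPolynomial

theorem isAdmissible_of_mem_base {b : Fin 2 → Coefficient → ℂ} (h : parameterPoint b ∈ base) :
    IsAdmissible b := by
  rw [base, TopologicalSpace.Opens.mem_sSup] at h
  obtain ⟨U, hU, hb⟩ := h
  exact hU b hb

/-- A common zero of two binary forms gives a common linear factor. -/
theorem not_isRelPrime_quarticForm {a a' : Coefficient → ℂ} {v : Fin 5 → ℂ}
    (hv : v 1 = 1 ∨ v 2 = 1) (h : ∑ i, a (.Q i) * formMonomial v (.Q i) = 0)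
    (h' : ∑ i, a' (.Q i) * formMonomial v (.Q i) = 0) :
    ¬ IsRelPrime (quarticForm a) (quarticForm a') := by
  intro hrel
  have hunit : ∀ i j : Fin 5, ∀ c : ℂ, ¬ IsUnit (X i - C c * X j : MvPolynomial (Fin 5) ℂ) := by
    intro i j c hu
    simpa using hu.map (eval (0 : Fin 5 → ℂ))
  rcases hv with hv | hv
  · have hdvd : ∀ a : Coefficient → ℂ, ∑ i, a (.Q i) * formMonomial v (.Q i) = 0 →
        X 2 - C (v 2) * X 1 ∣ quarticForm a := by
      intro a h
      -- Subtracting `Q(x₁, v₂ x₁) = Q(1, v₂) x₁⁴ = 0` turns each power of `x₂` into a difference of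
      -- powers, divisible by `x₂ - v₂ x₁`.
      have h1 : quarticForm a = ∑ i : Fin 5, C (a (.Q i)) * X 1 ^ (4 - (i : ℕ)) *
          (X 2 ^ (i : ℕ) - (C (v 2) * X 1) ^ (i : ℕ)) := by
        have h2 : ∑ i : Fin 5, C (a (.Q i)) * X 1 ^ (4 - (i : ℕ)) * (C (v 2) * X 1) ^ (i : ℕ) =
            C (∑ i, a (.Q i) * formMonomial v (.Q i)) * (X 1 : MvPolynomial (Fin 5) ℂ) ^ 4 := by
          rw [map_sum, Finset.sum_mul]
          refine Finset.sum_congr rfl fun i _ => ?_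
          rw [formMonomial, hv, one_pow, one_mul, map_mul, map_pow,
            show (X 1 : MvPolynomial (Fin 5) ℂ) ^ 4 = X 1 ^ (4 - (i : ℕ)) * X 1 ^ (i : ℕ) by
              rw [← pow_add, Nat.sub_add_cancel (by omega)]]
          ring
        rw [h, map_zero, zero_mul] at h2
        simp only [mul_sub, Finset.sum_sub_distrib, h2, sub_zero]
        rfl
      rw [h1]
      exact Finset.dvd_sum fun i _ => Dvd.dvd.mul_left (sub_dvd_pow_sub_pow _ _ _) _
    exact hunit _ _ _ (hrel (hdvd a h) (hdvd a' h'))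
  · have hdvd : ∀ a : Coefficient → ℂ, ∑ i, a (.Q i) * formMonomial v (.Q i) = 0 →
        X 1 - C (v 1) * X 2 ∣ quarticForm a := by
      intro a h
      have h1 : quarticForm a = ∑ i : Fin 5, C (a (.Q i)) *
          (X 1 ^ (4 - (i : ℕ)) - (C (v 1) * X 2) ^ (4 - (i : ℕ))) * X 2 ^ (i : ℕ) := by
        have h2 : ∑ i : Fin 5, C (a (.Q i)) * (C (v 1) * X 2) ^ (4 - (i : ℕ)) * X 2 ^ (i : ℕ) =
            C (∑ i, a (.Q i) * formMonomial v (.Q i)) * (X 2 : MvPolynomial (Fin 5) ℂ) ^ 4 := by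
          rw [map_sum, Finset.sum_mul]
          refine Finset.sum_congr rfl fun i _ => ?_
          rw [formMonomial, hv, one_pow, mul_one, map_mul, map_pow,
            show (X 2 : MvPolynomial (Fin 5) ℂ) ^ 4 = X 2 ^ (4 - (i : ℕ)) * X 2 ^ (i : ℕ) by
              rw [← pow_add, Nat.sub_add_cancel (by omega)]]
          ring
        rw [h, map_zero, zero_mul] at h2
        simp only [mul_sub, sub_mul, Finset.sum_sub_distrib, h2, sub_zero]
        rfl
      rw [h1]
      exact Finset.dvd_sum fun i _ =>
        Dvd.dvd.mul_right (Dvd.dvd.mul_left (sub_dvd_pow_sub_pow _ _ _) _) _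
    exact hunit _ _ _ (hrel (hdvd a h) (hdvd a' h'))

/-- The surfaces that belong to admissible parameters do not contain fixed points of the
involution. -/
theorem not_isAdmissible (κ : Fin 3) {b : Fin 2 → Coefficient → ℂ} {v : Fin 5 → ℂ}
    (hv : v (chartVar κ) = 1) (hv' : ∀ i, chartSign κ i = -1 → v i = 0)
    (h : ∀ l, v (squareVar l) ^ 2 + ∑ m, b l m * formMonomial v m = 0) : ¬ IsAdmissible b := by
  intro hb
  have h3 : v 3 = 0 := hv' 3 (by fin_cases κ <;> rfl)
  have h4 : v 4 = 0 := hv' 4 (by fin_cases κ <;> rfl)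
  have h' : ∀ l, b l .c * v 0 ^ 4 + ((∑ i, b l (.q i) * formMonomial v (.q i)) +
      ∑ i, b l (.Q i) * formMonomial v (.Q i)) = 0 := by
    intro l
    have h1 := h l
    have h2 : v (squareVar l) = 0 := by fin_cases l; exacts [h3, h4]
    rw [h2, ← coefficientEquiv.symm.sum_comp, Fintype.sum_sum_type, Fintype.sum_sum_type] at h1
    simpa [coefficientEquiv, formMonomial] using h1
  by_cases hκ : κ = 0
  -- Where `w = 1`, all other coordinates are negated, so the point is `[1 : 0 : 0 : 0 : 0]` and the
  -- equations say `c = c' = 0`.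
  · subst hκ
    have h0 : v 0 = 1 := hv
    have h1 : v 1 = 0 := hv' 1 rfl
    have h2 : v 2 = 0 := hv' 2 rfl
    have hc : ∀ l, b l .c = 0 := by
      intro l
      simpa [Fin.sum_univ_five, Fin.sum_univ_three, formMonomial, h0, h1, h2] using h' l
    exact hb.c_ne_zero.elim (fun h => h (hc 0)) fun h => h (hc 1)
  -- On the other charts `w`, `z₃` and `z₄` vanish, and what remains is a common zero of `Q` and
  -- `Q'`.
  · have h0 : v 0 = 0 := hv' 0 (by fin_cases κ <;> first | exact absurd rfl hκ | rfl)
    have hQ : ∀ l, ∑ i, b l (.Q i) * formMonomial v (.Q i) = 0 := by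
      intro l
      have h1 := h' l
      simpa [h0, formMonomial] using h1
    refine not_isRelPrime_quarticForm ?_ (hQ 0) (hQ 1) hb.isRelPrime
    fin_cases κ
    exacts [absurd rfl hκ, Or.inl hv, Or.inr hv]

theorem comap_coeffMap_vanishingIdeal (κ : Fin 3) (x : ChartIndex κ → ℂ) (r : ParameterRing) :
    eval x (coeffMap κ r) = eval (fun p => eval x (chartParam κ p)) r := by
  have : (eval x).comp (coeffMap κ) = eval fun p => eval x (chartParam κ p) := by
    refine ringHom_ext (fun a => ?_) fun p => ?_
    · rw [RingHom.comp_apply, coeffMap, eval₂Hom_C, eval_C, eval_C]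
    · rw [RingHom.comp_apply, coeffMap, eval₂Hom_X', eval_X]
  exact RingHom.congr_fun this r

/-- On a chart, the coordinates that change their sign do not vanish simultaneously over an
admissible parameter. -/
theorem exists_notMem_of_mem_base (κ : Fin 3) (q : PrimeSpectrum (ChartRing κ))
    (hq : q.comap (coeffMap κ) ∈ base.carrier) :
    ∃ x ∈ negated κ, (X x : ChartRing κ) ∉ q.asIdeal := by
  by_contra! H
  let Z : Set (PrimeSpectrum (ChartRing κ)) := PrimeSpectrum.zeroLocus ((fun x => X x) '' negated κ)
  let U : Set (PrimeSpectrum (ChartRing κ)) := PrimeSpectrum.comap (coeffMap κ) ⁻¹' base.carrier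
  have hZ : IsClosed Z := PrimeSpectrum.isClosed_zeroLocus _
  have hU : IsOpen U := base.2.preimage (PrimeSpectrum.continuous_comap _)
  have hqZ : q ∈ U ∩ Z := ⟨hq, by rintro _ ⟨x, hx, rfl⟩; exact H x hx⟩
  -- Admissibility is a condition on complex points only, while `q` is arbitrary. The bad locus is
  -- locally closed in a Jacobson space, so if nonempty it has a closed point, which is a complex
  -- point by the Nullstellensatz.
  obtain ⟨m, ⟨hmU, hmZ⟩, hm⟩ := nonempty_inter_closedPoints ⟨q, hqZ⟩
    (hU.isLocallyClosed.inter hZ.isLocallyClosed)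
  have hmax : m.asIdeal.IsMaximal := (PrimeSpectrum.isClosed_singleton_iff_isMaximal m).mp hm
  obtain ⟨x, hx⟩ := isMaximal_iff_eq_vanishingIdeal_singleton.mp hmax
  have hmem : ∀ p : ChartRing κ, p ∈ m.asIdeal ↔ eval x p = 0 := by
    intro p
    rw [hx, mem_vanishingIdeal_singleton_iff, aeval_eq_eval]
  have hb : m.comap (coeffMap κ) = parameterPoint fun l m => eval x (chartParam κ (l, m)) := by
    refine PrimeSpectrum.ext (Ideal.ext fun r => ?_)
    refine (hmem _).trans ?_
    rw [comap_coeffMap_vanishingIdeal]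
    rfl
  have hmU' : m.comap (coeffMap κ) ∈ base.carrier := hmU
  rw [hb] at hmU'
  refine not_isAdmissible κ (v := fun i => eval x (chartCoord κ i)) ?_ ?_ ?_
    (isAdmissible_of_mem_base hmU')
  · rw [chartCoord_chartVar, map_one]
  · intro i hi
    have hne : i ≠ chartVar κ := by
      rintro rfl
      rw [chartSign_chartVar] at hi
      norm_num at hi
    rw [chartCoord, dif_neg hne]
    exact (hmem _).mp (hmZ ⟨.inl ⟨i, hne⟩, ⟨_, rfl, hi⟩, rfl⟩)
  · intro l
    have h1 := congrArg (eval x) (dehomogenize_equation κ l)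
    rw [dehomogenize, eval₂Hom_equation, map_add, map_sum, map_pow, map_zero] at h1
    rw [← h1]
    congr 1
    refine Finset.sum_congr rfl fun m _ => ?_
    rw [map_mul, coeffMap_universalPair, map_formMonomial]

end TodorovFamily

/-! ### Smoothness of the quotient away from fixed points -/

namespace TodorovFamily.IsInvolutionQuotient

variable {X Y : Scheme.{0}} {τ : X ⟶ X} {π : X ⟶ Y}

/-- The functions on a chart of the quotient, as the ring of invariants of the functions on the
corresponding chart. -/
theorem exists_invariants (h : IsInvolutionQuotient τ π) {P : CommRingCat.{0}} (j : Spec P ⟶ X)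
    [IsOpenImmersion j] (σ : P ⟶ P) (hj : j ≫ τ = Spec.map σ ≫ j) (U : Y.Opens)
    (hU : π ⁻¹ᵁ U = j.opensRange) (e : ⊤ ≤ (j ≫ π) ⁻¹ᵁ U) : ∃ ψ : Γ(Y, U) ⟶ P,
      ψ ≫ (Scheme.ΓSpecIso P).inv = (j ≫ π).appLE U ⊤ e ∧ Function.Injective ψ ∧
      ∀ a, σ a = a ↔ a ∈ ψ.hom.range := by
  have hτ : π ⁻¹ᵁ U ≤ τ ⁻¹ᵁ (π ⁻¹ᵁ U) := by rw [← Scheme.Hom.comp_preimage, h.comp_eq]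
  have hjV : ⊤ ≤ j ⁻¹ᵁ (π ⁻¹ᵁ U) := e
  have hiso := isIso_appLE_top j hU hjV
  have hbij := (ConcreteCategory.isIso_iff_bijective _).mp hiso
  have hbij' := (ConcreteCategory.isIso_iff_bijective (Scheme.ΓSpecIso P).inv).mp inferInstance
  have hfac : (j ≫ π).appLE U ⊤ e = π.app U ≫ j.appLE _ ⊤ hjV := by
    rw [Scheme.Hom.app_eq_appLE, Scheme.Hom.appLE_comp_appLE]
  have hinj : Function.Injective (π.app U) := by
    intro a b hab
    refine ((h.functions U (π.app U a)).mp ?_).unique rfl hab.symm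
    rw [Scheme.Hom.app_eq_appLE, ← CommRingCat.comp_apply, Scheme.Hom.appLE_comp_appLE]
    simp only [h.comp_eq]
  have hψ : ((j ≫ π).appLE U ⊤ e ≫ (Scheme.ΓSpecIso P).hom) ≫ (Scheme.ΓSpecIso P).inv =
      (j ≫ π).appLE U ⊤ e := by simp
  refine ⟨(j ≫ π).appLE U ⊤ e ≫ (Scheme.ΓSpecIso P).hom, hψ, ?_, fun a => ⟨fun ha => ?_, ?_⟩⟩
  · refine Function.Injective.of_comp (f := (Scheme.ΓSpecIso P).inv) ?_
    have h1 : Function.Injective ((j ≫ π).appLE U ⊤ e) := by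
      rw [hfac]
      exact hbij.1.comp hinj
    rw [← hψ] at h1
    exact h1
  · obtain ⟨s, hs⟩ := hbij.2 ((Scheme.ΓSpecIso P).inv a)
    have hsτ : τ.appLE _ _ hτ s = s := by
      apply hbij.1
      have h1 : (j ≫ τ).appLE (π ⁻¹ᵁ U) ⊤ (hjV.trans (fun x hx => hτ hx)) =
        (Spec.map σ ≫ j).appLE (π ⁻¹ᵁ U) ⊤ (by rw [← hj]; exact (hjV.trans (fun x hx => hτ hx))) := by
        congr 1
      rw [← Scheme.Hom.appLE_comp_appLE j τ _ _ ⊤ hτ hjV,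
        ← Scheme.Hom.appLE_comp_appLE (Spec.map σ) j _ ⊤ ⊤ hjV le_rfl] at h1
      refine congr($h1 s).trans ?_
      have h2 : (Spec.map σ).appLE ⊤ ⊤ le_rfl = (Spec.map σ).appTop := (Spec.map σ).appLE_eq_app
      rw [CommRingCat.comp_apply, hs, h2]
      have h3 := congr($(Scheme.ΓSpecIso_inv_naturality σ) a)
      rw [CommRingCat.comp_apply, CommRingCat.comp_apply, ha] at h3
      exact h3.symm
    obtain ⟨t, ht, -⟩ := (h.functions U s).mp hsτ
    refine ⟨t, hbij'.1 ?_⟩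
    refine congr($hψ t).trans ?_
    rw [hfac, ← hs, CommRingCat.comp_apply]
    exact congrArg _ ht
  · rintro ⟨b, rfl⟩
    apply hbij'.1
    have h1 : (j ≫ π).appLE U ⊤ e = (Spec.map σ ≫ (j ≫ π)).appLE U ⊤ (by
        rw [← Category.assoc, ← hj, Category.assoc, h.comp_eq]; exact e) := by
      congr 1
      rw [← Category.assoc, ← hj, Category.assoc, h.comp_eq]
    rw [← Scheme.Hom.appLE_comp_appLE (Spec.map σ) (j ≫ π) U ⊤ ⊤ e le_rfl] at h1
    have h2 : (Spec.map σ).appLE ⊤ ⊤ le_rfl = (Spec.map σ).appTop := (Spec.map σ).appLE_eq_app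
    have h3 := congr($h1 b)
    rw [h2, ← hψ] at h3
    refine Eq.trans ?_ h3.symm
    exact congr($(Scheme.ΓSpecIso_inv_naturality σ) _)

end TodorovFamily.IsInvolutionQuotient

namespace AlgebraicGeometry

theorem smooth_ι_comp_of_appLE {Y : Scheme.{0}} {R : CommRingCat.{0}} (h : Y ⟶ Spec R)
    {W : Y.Opens} (hW : IsAffineOpen W) (e : W ≤ h ⁻¹ᵁ ⊤) (hs : (h.appLE ⊤ W e).hom.Smooth) :
    Smooth (W.ι ≫ h) := by
  rw [← hW.isoSpec_hom_fromSpec, Category.assoc,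
    ← IsAffineOpen.SpecMap_appLE_fromSpec h (isAffineOpen_top _) hW e,
    IsAffineOpen.fromSpec_top]
  have : Smooth (Spec.map (h.appLE ⊤ W e)) :=
    (HasRingHomProperty.Spec_iff (P := @Smooth)).mpr hs
  infer_instance

theorem isZariskiLocalAtSource_smooth :
    IsZariskiLocalAtSource (@Smooth : MorphismProperty Scheme.{0}) :=
  HasRingHomProperty.instIsZariskiLocalAtSource

theorem smooth_ι_comp_of_forall_mem {Y Z : Scheme.{0}} (h : Y ⟶ Z) (S : Y.Opens)
    (H : ∀ y ∈ S, ∃ W : Y.Opens, y ∈ W ∧ Smooth (W.ι ≫ h)) : Smooth (S.ι ≫ h) := by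
  choose W hy hW using H
  have := isZariskiLocalAtSource_smooth
  refine IsZariskiLocalAtSource.of_iSup_eq_top (P := @Smooth)
    (U := fun y : S.toScheme => S.ι ⁻¹ᵁ W y.1 y.2) ?_ fun y => ?_
  · exact top_le_iff.mp fun y _ => TopologicalSpace.Opens.mem_iSup.mpr ⟨y, hy y.1 y.2⟩
  · rw [← Category.assoc, ← morphismRestrict_ι, Category.assoc]
    have := hW y.1 y.2
    infer_instance

end AlgebraicGeometry

namespace TodorovFamily.IsInvolutionQuotient

open MvPolynomial

variable {Z Y : Scheme.{0}} {τ : Z ⟶ Z} {π : Z ⟶ Y}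

/-- The quotient by an involution is smooth at the images of the points of a chart `𝔸ⁿ`, on which
the involution changes the signs of some coordinates, at which one of these coordinates does not
vanish. -/
theorem exists_smooth (h : IsInvolutionQuotient τ π) {ι : Type} [Finite ι] {N : Set ι}
    (j : Spec (.of (MvPolynomial ι ℂ)) ⟶ Z) [IsOpenImmersion j]
    (σ : MvPolynomial ι ℂ →+* MvPolynomial ι ℂ)
    (hj : j ≫ τ = Spec.map (CommRingCat.ofHom σ) ≫ j) (hC : ∀ a, σ (C a) = C a)
    (hN : ∀ i ∈ N, σ (X i) = -X i) (hN' : ∀ i ∉ N, σ (X i) = X i) {U : Y.Opens}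
    (hUa : IsAffineOpen U) (hU : π ⁻¹ᵁ U = j.opensRange) (p : Y ⟶ Spec (.of ℂ))
    (hp : j ≫ π ≫ p = Spec.map (CommRingCat.ofHom C)) {i : ι} (hi : i ∈ N) :
    ∃ W : Y.Opens, Smooth (W.ι ≫ p) ∧
      ∀ q : PrimeSpectrum (MvPolynomial ι ℂ), X i ∉ q.asIdeal → π (j q) ∈ W := by
  have e : ⊤ ≤ (j ≫ π) ⁻¹ᵁ U := by
    rw [Scheme.Hom.comp_preimage, hU, Scheme.Hom.preimage_opensRange]
  obtain ⟨ψ, hψ, hinj, hinv⟩ := h.exists_invariants j (CommRingCat.ofHom σ) hj U hU e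
  -- The variable `X i` does not descend to the quotient, but its square does; the required open
  -- subset is where the descended function `v` is invertible.
  obtain ⟨v, hv⟩ : X i ^ 2 ∈ ψ.hom.range := (hinv _).mp (by
    change σ (X i ^ 2) = _
    rw [map_pow, hN i hi, neg_sq])
  have hUt : U ≤ p ⁻¹ᵁ ⊤ := le_top
  have hWt : Y.basicOpen v ≤ p ⁻¹ᵁ ⊤ := le_top
  have hloc := hUa.isLocalization_basicOpen v
  refine ⟨Y.basicOpen v, smooth_ι_comp_of_appLE p (hUa.basicOpen v) hWt ?_, fun q hq => ?_⟩
  · have hc : (Scheme.ΓSpecIso (.of ℂ)).inv ≫ p.appLE ⊤ U hUt ≫ ψ = CommRingCat.ofHom C := by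
      rw [← cancel_mono (Scheme.ΓSpecIso (.of (MvPolynomial ι ℂ))).inv, Category.assoc,
        Category.assoc, hψ, Scheme.ΓSpecIso_inv_naturality, Scheme.Hom.appLE_comp_appLE]
      congr 1
      have h3 : (j ≫ π ≫ p).appLE ⊤ ⊤ le_top = (Spec.map (CommRingCat.ofHom C)).appTop := by
        rw [hp]
        exact Scheme.Hom.appLE_eq_app _
      exact h3
    have h1 := smooth_of_signChange (L := Γ(Y, Y.basicOpen v)) hC hN hN' ψ.hom hinj hinv
      ((Scheme.ΓSpecIso (.of ℂ)).inv ≫ p.appLE ⊤ U hUt).hom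
      (fun a => congr($hc a)) hi hv
    have h2 : (Scheme.ΓSpecIso (.of ℂ)).hom.hom.Smooth :=
      RingHom.Smooth.of_bijective ((ConcreteCategory.isIso_iff_bijective _).mp inferInstance)
    convert h2.comp h1 using 1
    ext a
    have h4 : (Scheme.ΓSpecIso (.of ℂ)).inv ((Scheme.ΓSpecIso (.of ℂ)).hom a) = a :=
      congr($((Scheme.ΓSpecIso (.of ℂ)).hom_inv_id) a)
    have h5 := Scheme.Hom.appLE_map p hUt (homOfLE (Y.basicOpen_le v)).op
    rw [← h5]
    refine Eq.trans ?_ (congrArg (fun a => Y.presheaf.map (homOfLE (Y.basicOpen_le v)).op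
      (p.appLE ⊤ U hUt a)) h4.symm)
    rfl
  · change j q ∈ π ⁻¹ᵁ Y.basicOpen v
    have h1 : q ∈ (Spec (.of (MvPolynomial ι ℂ))).basicOpen ((j ≫ π).appLE U ⊤ e v) := by
      rw [← hψ]
      change q ∈ (Spec (.of (MvPolynomial ι ℂ))).basicOpen
        ((Scheme.ΓSpecIso (.of (MvPolynomial ι ℂ))).inv (ψ v))
      rw [basicOpen_eq_of_affine]
      change ψ.hom v ∉ q.asIdeal
      rw [hv]
      exact fun h => hq (q.2.mem_of_pow_mem 2 h)
    rw [Scheme.basicOpen_appLE] at h1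
    exact h1.2

end TodorovFamily.IsInvolutionQuotient

/-! ### Assembly: the family over `B` and its quotient -/

namespace AlgebraicGeometry

/-- A morphism from the spectrum of a field factors through one of the members of an open cover. -/
theorem exists_comp_eq_of_iSup_eq_top {K : Type} [Field K] {X : Scheme.{0}} {ι : Type}
    {U : ι → Scheme.{0}} (j : ∀ i, U i ⟶ X) [∀ i, IsOpenImmersion (j i)]
    (hj : ⨆ i, (j i).opensRange = ⊤) (x : Spec (.of K) ⟶ X) : ∃ i y, y ≫ j i = x := by
  obtain ⟨i, hi⟩ := TopologicalSpace.Opens.mem_iSup.mp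
    (hj.ge (Set.mem_univ (x (IsLocalRing.closedPoint K))))
  refine ⟨i, IsOpenImmersion.lift (j i) x ?_, IsOpenImmersion.lift_fac _ _ _⟩
  rintro _ ⟨z, rfl⟩
  rw [Subsingleton.elim z (IsLocalRing.closedPoint K)]
  exact hi

theorem isImmersion_comp_ι {X Y : Scheme.{0}} {U : Y.Opens} (f : X ⟶ U.toScheme)
    (hf : IsClosedImmersion f) : IsImmersion (f ≫ U.ι) :=
  inferInstance

end AlgebraicGeometry

namespace TodorovFamily

open MvPolynomial

attribute [local instance] MvPolynomial.gradedAlgebra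

/-- The involution of the complete intersection over all of `𝔸¹⁸`. -/
abbrev projInvolution : Proj (coordGrading universalPair) ⟶ Proj (coordGrading universalPair) :=
  Proj.map (coordInvolution universalPair) (coordInvolution_irrelevant universalPair)

/-- The structure morphism of the complete intersection over all of `𝔸¹⁸`. -/
abbrev projToParameter : Proj (coordGrading universalPair) ⟶ parameterSpace :=
  projToSpec (coordGrading universalPair)

/-- The structure morphism of `𝔸¹⁸`. -/
abbrev parameterToSpec : parameterSpace ⟶ Spec (.of ℂ) :=
  Spec.map (CommRingCat.ofHom (algebraMap ℂ ParameterRing))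

theorem chart_toParameter_toSpec (κ : Fin 3) : chart κ ≫ projToParameter ≫ parameterToSpec =
    Spec.map (CommRingCat.ofHom C) := by
  rw [← Category.assoc, chart_toSpec, ← Spec.map_comp, ← CommRingCat.ofHom_comp]
  congr 2
  exact RingHom.ext fun a => eval₂Hom_C _ _ _

theorem smooth_projToParameter : Smooth (projToParameter ≫ parameterToSpec) := by
  have := isZariskiLocalAtSource_smooth
  have h (κ : Fin 3) : Smooth (chart κ ≫ projToParameter ≫ parameterToSpec) := by
    rw [chart_toParameter_toSpec]
    refine (HasRingHomProperty.Spec_iff (P := @Smooth)).mpr ?_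
    exact (RingHom.smooth_algebraMap (R := ℂ) (S := ChartRing κ)).mpr
      ⟨inferInstance, inferInstance⟩
  exact IsZariskiLocalAtSource.of_openCover (P := @Smooth) chartCover.openCover h

theorem projInvolution_comp_self : projInvolution ≫ projInvolution = 𝟙 _ := by
  refine hom_ext_chart fun κ => ?_
  have h : (chartInvolution κ).comp (chartInvolution κ) = RingHom.id _ :=
    RingHom.ext (chartInvolution_involutive κ)
  rw [← Category.assoc, chart_involution, Category.assoc, chart_involution, ← Category.assoc,
    ← Spec.map_comp, ← CommRingCat.ofHom_comp, Category.comp_id, h]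
  exact (congrArg (· ≫ chart κ) (Spec.map_id _)).trans (Category.id_comp _)

theorem projInvolution_toParameter : projInvolution ≫ projToParameter = projToParameter :=
  involution_toSpec universalPair

/-- The part of the complete intersection over the admissible parameters. -/
abbrev projOpen : (Proj (coordGrading universalPair)).Opens := projToParameter ⁻¹ᵁ base

theorem smooth_projOpen : Smooth (projOpen.ι ≫ projToParameter ≫ parameterToSpec) :=
  have := isZariskiLocalAtSource_smooth
  IsZariskiLocalAtSource.comp (P := @Smooth) smooth_projToParameter _

theorem projOpen_le : projOpen ≤ projInvolution ⁻¹ᵁ projOpen := by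
  rw [← Scheme.Hom.comp_preimage, projInvolution_toParameter]

theorem exists_notMem_of_mem_projOpen (κ : Fin 3) {q : PrimeSpectrum (ChartRing κ)}
    (hq : chart κ q ∈ projOpen) : ∃ x ∈ negated κ, (X x : ChartRing κ) ∉ q.asIdeal := by
  refine exists_notMem_of_mem_base κ q ?_
  have h : chart κ ≫ projToParameter = _ := chart_toSpec κ
  have hq' : (chart κ ≫ projToParameter) q ∈ base := hq
  rw [h] at hq'
  exact hq'

/-- A fixed complex point lies in some chart, and there its value at each negated variable equals
its own negative. All negated variables then vanish, which is impossible over `B`. -/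
theorem no_fixed_point (x : Spec (.of ℂ) ⟶ projOpen.toScheme)
    (hx : x ≫ projInvolution.resLE projOpen projOpen projOpen_le = x) : False := by
  obtain ⟨κ, y, hy⟩ := exists_comp_eq_of_iSup_eq_top chart iSup_opensRange_chart (x ≫ projOpen.ι)
  have h1 : y ≫ Spec.map (CommRingCat.ofHom (chartInvolution κ)) = y := by
    rw [← cancel_mono (chart κ), Category.assoc, ← chart_involution, ← Category.assoc, hy]
    conv_rhs => rw [← hx]
    rw [Category.assoc, Category.assoc, Scheme.Hom.resLE_comp_ι]
  obtain ⟨χ, rfl⟩ := Spec.map_surjective y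
  have h2 : CommRingCat.ofHom (chartInvolution κ) ≫ χ = χ :=
    Spec.map_injective (by rw [Spec.map_comp, h1])
  let pt : Spec (.of ℂ) := IsLocalRing.closedPoint ℂ
  obtain ⟨i, hi, hq⟩ := exists_notMem_of_mem_projOpen κ (q := Spec.map χ pt) (by
    rw [← Scheme.Hom.comp_apply, hy, Scheme.Hom.comp_apply]
    exact (x pt).2)
  refine hq ?_
  have h3 : χ (chartInvolution κ (X i)) = χ (X i) := congr($h2 (X i))
  rw [chartInvolution_of_mem hi, map_neg] at h3
  have h4 : χ (X i) = 0 := self_eq_neg.mp h3.symm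
  change χ (X i) ∈ pt.asIdeal
  rw [h4]
  exact zero_mem _

theorem isQuasiProjective_ι_comp {X : Scheme.{0}} {n : ℕ} (f : X ⟶ projectiveSpace n)
    (hf : IsImmersion f) {s : X ⟶ Spec (.of ℂ)} (hs : f ≫ projectiveSpaceToSpec n = s)
    (U : X.Opens) : IsQuasiProjective (U.ι ≫ s) :=
  ⟨n, U.ι ≫ f, inferInstance, by rw [Category.assoc, hs]⟩

theorem isQuasiProjective_projOpen :
    IsQuasiProjective (projOpen.ι ≫ projToParameter ≫ parameterToSpec) := by
  have := totalSystem.isClosedImmersion_toTarget totalSystem_surjective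
  have h : IsImmersion (totalSystem.toTarget ≫ totalSystem.target.ι) :=
    isImmersion_comp_ι _ this
  rw [LinearSystem.toTarget_ι] at h
  exact isQuasiProjective_ι_comp (n := totalSystem.n) totalSystem.toProjectiveSpace h
    totalSystem.toProjectiveSpace_toSpec _

/-- The quotient is formed over all of `𝔸¹⁸`, fixed points included. The projection descends to it
because it is invariant and `𝔸¹⁸` is affine. Only then is everything restricted to the preimage of
`B`, where some negated variable is nonzero at every point and smoothness follows. -/
theorem exists_quotient : ∃ (S : Scheme.{0}) (π : projOpen.toScheme ⟶ S) (p : S ⟶ base.toScheme),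
    IsInvolutionQuotient (projInvolution.resLE projOpen projOpen projOpen_le) π ∧
      π ≫ p = projToParameter.resLE base projOpen le_rfl ∧
      Smooth (p ≫ base.ι ≫ parameterToSpec) ∧
      IsQuasiProjective (p ≫ base.ι ≫ parameterToSpec) := by
  let L := invariantSystem
  have hquot := (L.involutionCharts mem_range_invariantSystem).isInvolutionQuotient
    (L.involution_toTarget coordInvolution_invariantSystem)
  obtain ⟨p, hp⟩ := hquot.exists_comp_eq projToParameter projInvolution_toParameter
  have hS : projOpen = L.toTarget.toImage ⁻¹ᵁ (p ⁻¹ᵁ base) := by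
    rw [← Scheme.Hom.comp_preimage, hp]
  have hps : p.resLE base (p ⁻¹ᵁ base) le_rfl ≫ base.ι ≫ parameterToSpec =
      (p ⁻¹ᵁ base).ι ≫ p ≫ parameterToSpec := by
    rw [← Category.assoc, Scheme.Hom.resLE_comp_ι, Category.assoc]
  have himm : (L.toTarget.imageι ≫ L.target.ι) ≫
      projToSpec (homogeneousSubmodule (Fin (L.n + 1)) ℂ) = p ≫ parameterToSpec := by
    -- The embedding of the image is over `ℂ`: this can be checked after composition with the
    -- quotient morphism, where it is the corresponding property of the linear system.
    apply hquot.hom_ext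
    rw [← Category.assoc _ p, hp, ← L.toProjectiveSpace_toSpec, ← L.toTarget_ι,
      ← Category.assoc, ← Category.assoc, Scheme.Hom.toImage_imageι]
  refine ⟨(p ⁻¹ᵁ base).toScheme, L.toTarget.toImage.resLE _ _ hS.le,
    p.resLE base (p ⁻¹ᵁ base) le_rfl, hquot.resLE hS _ _, ?_, ?_, ?_⟩
  · rw [Scheme.Hom.resLE_comp_resLE]
    simp only [hp]
  · rw [hps]
    refine smooth_ι_comp_of_forall_mem _ _ fun y hy => ?_
    obtain ⟨x, rfl⟩ := hquot.isQuotientMap.surjective y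
    obtain ⟨κ, q, rfl⟩ := TopologicalSpace.Opens.mem_iSup.mp
      (iSup_opensRange_chart.ge (Set.mem_univ x))
    have hq : chart κ q ∈ projOpen := hS.ge hy
    obtain ⟨i, hi, hiq⟩ := exists_notMem_of_mem_projOpen κ hq
    obtain ⟨W, hW, hqW⟩ := hquot.exists_smooth (chart κ) (chartInvolution κ) (chart_involution κ)
      (chartInvolution_C κ) (fun _ => chartInvolution_of_mem)
      (fun _ => chartInvolution_of_notMem)
      (U := L.toTarget.imageι ⁻¹ᵁ (L.targetChart κ).opensRange)
      ((isAffineOpen_opensRange (L.targetChart κ)).preimage L.toTarget.imageι)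
      (by rw [← Scheme.Hom.comp_preimage, Scheme.Hom.toImage_imageι,
            L.preimage_opensRange_targetChart])
      (p ≫ parameterToSpec)
      (by rw [← Category.assoc L.toTarget.toImage, hp, chart_toParameter_toSpec]) hi
    exact ⟨W, hqW q hiq, hW⟩
  · rw [hps]
    exact isQuasiProjective_ι_comp (n := L.n) _
      (isImmersion_comp_ι L.toTarget.imageι inferInstance) himm _

end TodorovFamily

end

theorem proposition2p8 :
    -- `𝒱` is a smooth quasi-projective variety
    (Smooth (TodorovFamily.totalSpaceToBase ≫ TodorovFamily.baseToSpec) ∧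
      TodorovFamily.IsQuasiProjective (TodorovFamily.totalSpaceToBase ≫ TodorovFamily.baseToSpec)) ∧
    -- `τ` is a fixed point free involution of `𝒱` over `B`
    (TodorovFamily.totalInvolution ≫ TodorovFamily.totalInvolution = 𝟙 TodorovFamily.totalSpace ∧
      TodorovFamily.totalInvolution ≫ TodorovFamily.totalSpaceToBase =
        TodorovFamily.totalSpaceToBase ∧
      ∀ x : Spec (.of ℂ) ⟶ TodorovFamily.totalSpace, x ≫ TodorovFamily.totalInvolution ≠ x) ∧
    -- `𝒮 = 𝒱 / τ` exists over `B` and is a smooth quasi-projective variety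
    ∃ (S : Scheme.{0}) (π : TodorovFamily.totalSpace ⟶ S) (p : S ⟶ TodorovFamily.base.toScheme),
      TodorovFamily.IsInvolutionQuotient TodorovFamily.totalInvolution π ∧
      π ≫ p = TodorovFamily.totalSpaceToBase ∧
      Smooth (p ≫ TodorovFamily.baseToSpec) ∧
      TodorovFamily.IsQuasiProjective (p ≫ TodorovFamily.baseToSpec) := by
  have hs : TodorovFamily.totalSpaceToBase ≫ TodorovFamily.baseToSpec =
      TodorovFamily.projOpen.ι ≫ TodorovFamily.projToParameter ≫ TodorovFamily.parameterToSpec := by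
    -- The total space and its morphisms unfold to the restrictions of the Proj over `𝔸¹⁸` to
    -- `projOpen`, so each identity is proved there and transferred by definitional equality.
    have h : TodorovFamily.projToParameter.resLE TodorovFamily.base TodorovFamily.projOpen le_rfl ≫
        TodorovFamily.base.ι ≫ TodorovFamily.parameterToSpec =
        TodorovFamily.projOpen.ι ≫ TodorovFamily.projToParameter ≫
          TodorovFamily.parameterToSpec := by
      rw [← Category.assoc, Scheme.Hom.resLE_comp_ι, Category.assoc]
    exact h
  refine ⟨⟨?_, ?_⟩, ⟨?_, ?_, TodorovFamily.no_fixed_point⟩, TodorovFamily.exists_quotient⟩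
  · rw [hs]
    exact TodorovFamily.smooth_projOpen
  · rw [hs]
    exact TodorovFamily.isQuasiProjective_projOpen
  · have h : TodorovFamily.projInvolution.resLE TodorovFamily.projOpen TodorovFamily.projOpen
        TodorovFamily.projOpen_le ≫ TodorovFamily.projInvolution.resLE TodorovFamily.projOpen
        TodorovFamily.projOpen TodorovFamily.projOpen_le = 𝟙 _ := by
      rw [← cancel_mono TodorovFamily.projOpen.ι, Category.assoc, Scheme.Hom.resLE_comp_ι,
        ← Category.assoc, Scheme.Hom.resLE_comp_ι, Category.assoc,
        TodorovFamily.projInvolution_comp_self, Category.comp_id, Category.id_comp]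
    exact h
  · have h : TodorovFamily.projInvolution.resLE TodorovFamily.projOpen TodorovFamily.projOpen
        TodorovFamily.projOpen_le ≫
        TodorovFamily.projToParameter.resLE TodorovFamily.base TodorovFamily.projOpen le_rfl =
        TodorovFamily.projToParameter.resLE TodorovFamily.base TodorovFamily.projOpen le_rfl := by
      rw [← cancel_mono TodorovFamily.base.ι, Category.assoc, Scheme.Hom.resLE_comp_ι,
        ← Category.assoc, Scheme.Hom.resLE_comp_ι, Category.assoc,
        TodorovFamily.projInvolution_toParameter]
    exact h
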